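/- Let $p\ge 1$ be an integer and let $\Delta^+=\mathbb{Z}_p*\mathbb{Z}$ be the free product of a cyclic group of order $p$ and an infinite cyclic group. For $n\ge 0$ let $c_f(n)$ be the number of conjugacy classes of free subgroups of (finite) index $n$ in $\Delta^+$ (so $c_f(0)=0$); these numbers are finite. Let $C_f(z)=\sum_{n\ge 0}c_f(n)z^n$ be the conjugacy growth series. A connected $(p,\infty)$-hypermap on $n\ge1$ darts is a pair $(\alpha,\sigma)$ of permutations of an $n$-element set such that $\langle\alpha,\sigma\rangle$ acts transitively and all cycles of $\alpha$ have length $p$; two of them are isomorphic if they are simultaneously conjugate by a bijection of the darts. Let $\mathfrak{H}_p(n)$ be the set of isomorphism classes (with $\mathfrak{H}_p(0)=\emptyset$), and let $\widetilde{H}(z)=\sum_{n\ge 0}|\mathfrak{H}_p(n)|z^n$. Then $C_f(z)=\widetilde{H}(z)$. Moreover, as formal power series over $\mathbb{Q}$, $$C_f(z)=\widetilde{H}(z)=\sum_{n=1}^\infty\frac{\mu(n)}{n}\sum_{k=1}^\infty \log(P_k\odot Q_k)(z_k)\Big|_{z_k=z^{nk}},$$ where $\mu$ is the Möbius function, $\phi$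 is the Euler totient function, $$P_k(z_k)=\exp\Big(\frac{1}{kp}\sum_{d\mid\gcd(k,p)}d\,\phi(d)\,z_k^{p/d}\Big),\qquad Q_k(z_k)=\sum_{d=0}^\infty z_k^d=\frac{1}{1-z_k},$$ and $\odot$ is the Hadamard product of cycle-index series in the variable $z_k$: if $A(z_k)=\sum_{i\ge0} a_i\frac{z_k^i}{k^i\,i!}$ and $B(z_k)=\sum_{i\ge0} b_i\frac{z_k^i}{k^i\,i!}$, then $(A\odot B)(z_k)=\sum_{i\ge0} a_ib_i\frac{z_k^i}{k^i\,i!}$. -/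

import Mathlib

open PowerSeries
open scoped Nat PowerSeries.WithPiTopology

noncomputable section

/-! ### Conjugacy classes of free subgroups of `ℤ_p * ℤ` -/

/-- The group `Δ⁺ = ℤ_p * ℤ`. -/
abbrev DeltaPlus (p : ℕ) : Type :=
  Monoid.Coprod (Multiplicative (ZMod p)) (Multiplicative ℤ)

/-- The free subgroups of (finite) index `n` in `G`. Mathlib's `Subgroup.index` is `0` for a subgroup
of infinite index, so finiteness of the index is stated separately; no subgroup has index `n = 0`. -/
abbrev FreeSubgroupOfIndex (G : Type) [Group G] (n : ℕ) : Type :=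
  {K : Subgroup G // IsFreeGroup K ∧ K.FiniteIndex ∧ K.index = n}

/-- Conjugacy of subgroups, `K' = g K g⁻¹` for some `g : G`. -/
def freeSubgroupSetoid (G : Type) [Group G] (n : ℕ) : Setoid (FreeSubgroupOfIndex G n) where
  r K K' := ∃ g : G, K'.1 = K.1.map (MulAut.conj g).toMonoidHom
  iseqv :=
    { refl := fun K => ⟨1, by ext x; simp⟩
      symm := by
        rintro K K' ⟨g, h⟩
        refine ⟨g⁻¹, ?_⟩
        rw [h, Subgroup.map_map]
        ext x
        simp [Subgroup.mem_map, mul_assoc]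
      trans := by
        rintro K K' K'' ⟨g, h⟩ ⟨g', h'⟩
        refine ⟨g' * g, ?_⟩
        rw [h', h, Subgroup.map_map]
        ext x
        simp [Subgroup.mem_map, mul_assoc] }

/-- The set of conjugacy classes of free subgroups of index `n` in `G`. -/
abbrev FreeSubgroupConjClass (G : Type) [Group G] (n : ℕ) : Type :=
  Quotient (freeSubgroupSetoid G n)

/-- The conjugacy growth series `C_f(z) = ∑ c_f(n) zⁿ` of `Δ⁺ = ℤ_p * ℤ`. -/
def conjugacyGrowthSeries (p : ℕ) : ℚ⟦X⟧ :=
  PowerSeries.mk fun n => (Nat.card (FreeSubgroupConjClass (DeltaPlus p) n) : ℚ)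

/-! ### Isomorphism classes of `(p,∞)`-hypermaps -/

/-- A connected oriented (labelled) hypermap `⟨D; α, σ⟩` with set of darts `D = Fin n`, `n ≥ 1`, all of
whose hyper-edges (the orbits of `α`) are `p`-gons. -/
structure PHypermap (p n : ℕ) where
  α : Equiv.Perm (Fin n)
  σ : Equiv.Perm (Fin n)
  nonempty : 0 < n
  transitive : ∀ x y : Fin n, ∃ g ∈ Subgroup.closure {α, σ}, g x = y
  edges : ∀ x : Fin n, Function.minimalPeriod α x = p

/-- Isomorphism of (unlabelled, unrooted) hypermaps: simultaneous conjugacy of `α` and `σ`. -/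
def hypermapSetoid (p n : ℕ) : Setoid (PHypermap p n) where
  r H H' := ∃ ψ : Equiv.Perm (Fin n), ψ * H.α * ψ⁻¹ = H'.α ∧ ψ * H.σ * ψ⁻¹ = H'.σ
  iseqv :=
    { refl := fun H => ⟨1, by simp, by simp⟩
      symm := by
        rintro H H' ⟨ψ, h₁, h₂⟩
        exact ⟨ψ⁻¹, by rw [← h₁]; group, by rw [← h₂]; group⟩
      trans := by
        rintro H H' H'' ⟨ψ, h₁, h₂⟩ ⟨ψ', h₁', h₂'⟩
        exact ⟨ψ' * ψ, by rw [← h₁', ← h₁]; group, by rw [← h₂', ← h₂]; group⟩ }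

/-- The set of isomorphism classes of connected `(p,∞)`-hypermaps on `n` darts. -/
abbrev HypermapIsoClass (p n : ℕ) : Type := Quotient (hypermapSetoid p n)

/-- The growth series `H̃(z)` for the number of isomorphism classes of connected
`(p,∞)`-hypermaps on `n` darts. -/
def hypermapGrowthSeries (p : ℕ) : ℚ⟦X⟧ :=
  PowerSeries.mk fun n => (Nat.card (HypermapIsoClass p n) : ℚ)

/-! ### The explicit formula -/

/-- The Hadamard product `A ⊙ B` of two series in the single cycle-index variable `z_m`. It is
`∑ a_i b_i z_mⁱ / λ!` for `A = ∑ a_i z_mⁱ / λ!` and `B = ∑ b_i z_mⁱ / λ!`, where `λ = mⁱ` is the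
partition into `i` parts equal to `m`, and `λ! = mⁱ i!`. -/
def hadamardProd (m : ℕ) (A B : ℚ⟦X⟧) : ℚ⟦X⟧ :=
  PowerSeries.mk fun i =>
    ((m : ℚ) ^ i * (i ! : ℚ) * coeff i A) * ((m : ℚ) ^ i * (i ! : ℚ) * coeff i B)
      / ((m : ℚ) ^ i * (i ! : ℚ))

/-- `P_m = exp ((1 / (m p)) ∑_{d ∣ (m, p)} d φ(d) z^{p/d})`. -/
def seriesP (p m : ℕ) : ℚ⟦X⟧ :=
  (PowerSeries.exp ℚ).subst
    (C (1 / ((m : ℚ) * (p : ℚ))) *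
      ∑ d ∈ (Nat.gcd m p).divisors, C ((d : ℚ) * (Nat.totient d : ℚ)) * X ^ (p / d) : ℚ⟦X⟧)

/-- `Q_m = ∑_{d ≥ 0} z^d = 1 / (1 - z)`. -/
def seriesQ : ℚ⟦X⟧ := PowerSeries.mk fun _ => 1

/-- The series `log (P_k ⊙ Q_k)(z_k)` evaluated at `z_k = z^{n k}`. -/
def logTerm (p : ℕ) (n k : ℕ+) : ℚ⟦X⟧ :=
  PowerSeries.expand ((n : ℕ) * (k : ℕ)) (mul_ne_zero n.ne_zero k.ne_zero)
    (PowerSeries.logOf (hadamardProd k (seriesP p k) seriesQ))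

/-- `s` is the sum of the family `f` of formal power series, for the usual topology on formal power
series (the product topology, with discrete coefficients): the coefficients of the finite partial
sums are eventually constant. -/
def HasFormalSum {ι : Type} (f : ι → ℚ⟦X⟧) (s : ℚ⟦X⟧) : Prop :=
  letI : TopologicalSpace ℚ := ⊥
  HasSum f s

end

/-!
Isomorphism classes of hypermaps correspond to conjugacy classes of free subgroups of
`Δ = ℤ_p * ℤ` by taking point stabilizers of the transitive representation of `Δ` by `α` and `σ`
(`card_freeSubgroupConjClass_eq`). The point is that all stabilizers of a representation of `Δ` are
free exactly if `ℤ_p` acts freely, i.e. all cycles of `α` have length `p`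
(`forall_isFreeGroup_stab_iff`). One direction holds because free groups are torsion-free. For the
other, if `ℤ_p` acts freely, the action groupoid is free on the arrows of the generator of `ℤ`
together with a star in each `ℤ_p`-orbit, and vertex groups of connected free groupoids are free.

The formula comes from counting subgroups of `ℤ × Δ`. By the exponential formula
(`mul_repCount_div_factorial`), if `E(n)` is the number of representations of a group on `n` points
with all stabilizers in a class of subgroups closed under conjugation, and `s(k)` the number of
subgroups of index `k` in this class, then `log ∑ E(n) zⁿ / n! = ∑ s(k) zᵏ / k`. This is applied
to the subgroups of `ℤ × Δ` that meet `ℤ` in `mℤ` and `Δ` in a free subgroup. A representation is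
here a permutation `π` with all cycles of length `m`, with `α` and `σ` commuting with `π`. The
pairs `(π, α)` are counted by `P_m(zᵐ)`, again by the exponential formula, now for `ℤ × ℤ_p`
(`coeff_seriesP`), and `σ` ranges over the centralizer of `π`, of order `mⁱ i!` on `m i` points, so
that the triples are counted by `(P_m ⊙ Q_m)(zᵐ)` (`coeff_hadamardProd`). Hence
`log (P_m ⊙ Q_m)` counts subgroups of `ℤ × Δ` (`coeff_logOf_hadamardProd`).

Summing over `m` gives the number `s(N)` of all subgroups of index `N` of `ℤ × Δ` whose intersection
with `Δ` is free. A subgroup of finite index of `ℤ × Δ` is given by its intersection `K` with `Δ`,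
the generator `j` of its projection to `ℤ` and an element of `N(K) / K`, and orbit counting yields
`s(N) = ∑_{d ∣ N} d c_f(d)` (`card_subgroupsWith_free`). Möbius inversion gives the result.
-/

/-! ### The exponential formula for permutation representations -/

section ExponentialFormula

variable {Γ : Type} [Group Γ]

/-- The stabilizer of `x` under the permutation representation `ρ`. -/
def stab {X : Type*} (ρ : Γ →* Equiv.Perm X) (x : X) : Subgroup Γ :=
  (MulAction.stabilizer (Equiv.Perm X) x).comap ρ

lemma mem_stab {X : Type*} {ρ : Γ →* Equiv.Perm X} {x : X} {g : Γ} :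
    g ∈ stab ρ x ↔ ρ g x = x := by
  simp [stab, MulAction.mem_stabilizer_iff]

/-- Points of the same orbit have conjugate stabilizers. -/
lemma stab_apply {X : Type*} (ρ : Γ →* Equiv.Perm X) (x : X) (g : Γ) :
    stab ρ (ρ g x) = (stab ρ x).map (MulAut.conj g).toMonoidHom := by
  ext h
  simp only [mem_stab, Subgroup.mem_map, MulEquiv.coe_toMonoidHom, MulAut.conj_apply]
  constructor
  · intro hh
    refine ⟨g⁻¹ * h * g, ?_, by group⟩
    simp [hh]
  · rintro ⟨k, hk, rfl⟩
    simp [mem_stab.1 hk]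

lemma index_stab_of_transitive {X : Type*} (ρ : Γ →* Equiv.Perm X) (x : X)
    (h : ∀ y, ∃ g, ρ g x = y) : (stab ρ x).index = Nat.card X := by
  let _ : MulAction Γ X := MulAction.compHom X ρ
  have : stab ρ x = MulAction.stabilizer Γ x := by
    ext g; exact mem_stab
  rw [this, MulAction.index_stabilizer]
  have : MulAction.orbit Γ x = Set.univ := by
    ext y
    obtain ⟨g, hg⟩ := h y
    simpa using ⟨g, hg⟩
  rw [this, Set.ncard_univ]

/-- The permutation representations of `Γ` on `X` all of whose point stabilizers satisfy `S`. Only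
properties `S` that are invariant under conjugation are of interest. -/
abbrev RepsWith (S : Subgroup Γ → Prop) (X : Type*) : Type _ :=
  {ρ : Γ →* Equiv.Perm X // ∀ x, S (stab ρ x)}

/-- The number of permutation representations on `n` points with all point stabilizers
satisfying `S`. -/
noncomputable def repCount (S : Subgroup Γ → Prop) (n : ℕ) : ℕ := Nat.card (RepsWith S (Fin n))

/-- The subgroups of index `k` that satisfy `S`. -/
abbrev SubgroupsWith (S : Subgroup Γ → Prop) (k : ℕ) : Type :=
  {L : Subgroup Γ // S L ∧ L.index = k}

/-- Transport of representations along a bijection of the underlying sets. -/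
def repsWithCongr (S : Subgroup Γ → Prop) {X Y : Type*} (e : X ≃ Y) :
    RepsWith S X ≃ RepsWith S Y :=
  (MulEquiv.monoidHomCongrRightEquiv e.permCongrHom).subtypeEquiv fun ρ => by
    rw [← e.forall_congr_right]
    refine forall_congr' fun x => ?_
    have key : stab ((MulEquiv.monoidHomCongrRightEquiv e.permCongrHom) ρ) (e x) = stab ρ x := by
      ext g
      simp [mem_stab]
    rw [key]

lemma card_repsWith (S : Subgroup Γ → Prop) (X : Type*) [Finite X] :
    Nat.card (RepsWith S X) = repCount S (Nat.card X) :=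
  Nat.card_congr (repsWithCongr S (Finite.equivFin X))

lemma finite_repsWith [∀ n, Finite (Γ →* Equiv.Perm (Fin n))] (S : Subgroup Γ → Prop)
    (X : Type*) [Finite X] : Finite (RepsWith S X) :=
  Finite.of_equiv _ (repsWithCongr S (Finite.equivFin X)).symm

open Classical in
/-- A representation on `X` that extends a given one `τ` along an embedding is the same thing as
a representation on the complement of the embedding. -/
noncomputable def extensionEquiv (S : Subgroup Γ → Prop) {A X : Type*} (τ : RepsWith S A)
    (e : A ↪ X) :
    {ρ : RepsWith S X // ∀ g a, ρ.1 g (e a) = e (τ.1 g a)} ≃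
      RepsWith S {x // ¬ x ∈ Set.range e} where
  toFun ρ :=
    ⟨{ toFun := fun g => (ρ.1.1 g).subtypePerm (by
        intro x
        rw [not_iff_not]
        constructor
        · rintro ⟨a, ha⟩
          refine ⟨τ.1 g⁻¹ a, ?_⟩
          rw [← ρ.2, ha]
          simp
        · rintro ⟨a, rfl⟩
          exact ⟨_, (ρ.2 g a).symm⟩)
       map_one' := by ext; simp
       map_mul' := by
         intros; ext
         simp only [map_mul, Equiv.Perm.subtypePerm_apply, Equiv.Perm.mul_apply] }, by
      intro x
      convert ρ.1.2 x.1 using 1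
      ext g
      simp [mem_stab, Subtype.ext_iff]⟩
  invFun ρ :=
    ⟨⟨(Equiv.Perm.subtypeCongrHom (· ∈ Set.range e)).comp
      (MonoidHom.prod
        ((Equiv.ofInjective e e.injective).permCongrHom.toMonoidHom.comp τ.1) ρ.1), by
      intro x
      by_cases hx : x ∈ Set.range e
      · obtain ⟨a, rfl⟩ := hx
        convert τ.2 a using 1
        ext g
        simp [mem_stab, Equiv.Perm.subtypeCongr.left_apply]
      · convert ρ.2 ⟨x, hx⟩ using 1
        ext g
        simp only [mem_stab, MonoidHom.comp_apply, Equiv.Perm.subtypeCongrHom_apply,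
          MonoidHom.prod_apply]
        rw [Equiv.Perm.subtypeCongr.right_apply _ _ hx]
        simp [Subtype.ext_iff]⟩, by
      intro g a
      simp [Equiv.Perm.subtypeCongr.left_apply]⟩
  left_inv ρ := by
    ext g x
    by_cases hx : x ∈ Set.range e
    · obtain ⟨a, rfl⟩ := hx
      simp [Equiv.Perm.subtypeCongr.left_apply, ρ.2]
    · simp [Equiv.Perm.subtypeCongr.right_apply _ _ hx]
  right_inv ρ := by
    ext g x
    simp [Equiv.Perm.subtypeCongr.right_apply _ _ x.2]

/-- The action of `Γ` on the cosets of `L`, as a permutation representation. -/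
def cosetRep {S : Subgroup Γ → Prop}
    (hS : ∀ L g, S L → S (L.map (MulAut.conj g).toMonoidHom)) (L : Subgroup Γ) (hL : S L) :
    RepsWith S (Γ ⧸ L) :=
  ⟨MulAction.toPermHom Γ (Γ ⧸ L), by
    have h1 : stab (MulAction.toPermHom Γ (Γ ⧸ L)) ((1 : Γ) : Γ ⧸ L) = L := by
      ext g
      simp only [mem_stab, MulAction.toPermHom_apply, MulAction.toPerm_apply]
      rw [← MulAction.mem_stabilizer_iff, MulAction.stabilizer_quotient]
    intro q
    induction q using QuotientGroup.induction_on with | _ g =>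
    have : ((g : Γ) : Γ ⧸ L) = MulAction.toPermHom Γ (Γ ⧸ L) g ((1 : Γ) : Γ ⧸ L) := by
      simp
    rw [this, stab_apply, h1]
    exact hS _ _ hL⟩

/-- Extensionality for triples of a subgroup, an embedding of its cosets and an extension along the
embedding, where the equality of the subgroups is only propositional. -/
lemma sigma_embedding_ext {S : Subgroup Γ → Prop}
    (hS : ∀ L g, S L → S (L.map (MulAut.conj g).toMonoidHom)) {X : Type} (ρ : RepsWith S X)
    (L L' : Subgroup Γ) (hL : S L) (hL' : S L') (h : L' = L) (e : (Γ ⧸ L) ↪ X) (e' : (Γ ⧸ L') ↪ X)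
    (he : ∀ g : Γ, e' (g : Γ ⧸ L') = e (g : Γ ⧸ L))
    (h1 : ∀ g a, ρ.1 g (e a) = e ((cosetRep hS L hL).1 g a))
    (h2 : ∀ g a, ρ.1 g (e' a) = e' ((cosetRep hS L' hL').1 g a)) :
    (⟨⟨L', hL'⟩, e', ρ, h2⟩ : Σ L : {L : Subgroup Γ // S L}, Σ e : (Γ ⧸ L.1) ↪ X,
        {ρ : RepsWith S X // ∀ g a, ρ.1 g (e a) = e ((cosetRep hS L.1 L.2).1 g a)}) =
      ⟨⟨L, hL⟩, e, ρ, h1⟩ := by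
  subst h
  obtain rfl : e' = e := by
    ext q
    induction q using QuotientGroup.induction_on with | _ g => exact he g
  rfl

/-- Pointed representations: the base point is recorded by its stabilizer `L`, the embedding of
the cosets of `L` onto its orbit, and the rest of the representation by its restriction to the
complement of the orbit. -/
noncomputable def pointedRepEquiv {S : Subgroup Γ → Prop}
    (hS : ∀ L g, S L → S (L.map (MulAut.conj g).toMonoidHom)) (X : Type) :
    RepsWith S X × X ≃
      Σ L : {L : Subgroup Γ // S L}, Σ e : (Γ ⧸ L.1) ↪ X, RepsWith S {x // ¬ x ∈ Set.range e} :=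
  calc RepsWith S X × X ≃ Σ L : {L : Subgroup Γ // S L}, Σ e : (Γ ⧸ L.1) ↪ X,
        {ρ : RepsWith S X // ∀ g a, ρ.1 g (e a) = e ((cosetRep hS L.1 L.2).1 g a)} :=
      { toFun := fun ρx => ⟨⟨stab ρx.1.1 ρx.2, ρx.1.2 _⟩,
          ⟨fun q => Quotient.liftOn' q (fun g => ρx.1.1 g ρx.2) (by
              intro a b hab
              rw [QuotientGroup.leftRel_apply, mem_stab, map_mul, map_inv,
                Equiv.Perm.mul_apply, Equiv.Perm.inv_eq_iff_eq] at hab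
              exact hab.symm), by
            intro a b
            induction a using QuotientGroup.induction_on with | _ a =>
            induction b using QuotientGroup.induction_on with | _ b =>
            intro h
            rw [QuotientGroup.eq, mem_stab, map_mul, map_inv, Equiv.Perm.mul_apply,
              Equiv.Perm.inv_eq_iff_eq]
            exact h.symm⟩,
          ρx.1, by
            intro g a
            induction a using QuotientGroup.induction_on with | _ a =>
            change ρx.1.1 g (ρx.1.1 a ρx.2) = ρx.1.1 (g * a) ρx.2
            simp⟩
        invFun := fun t => (t.2.2.1, t.2.1 ((1 : Γ) : Γ ⧸ t.1.1))
        left_inv := by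
          rintro ⟨ρ, x⟩
          change (ρ, ρ.1 1 x) = (ρ, x)
          simp
        right_inv := by
          rintro ⟨⟨L, hL⟩, e, ρ, h⟩
          have h1 : ∀ g : Γ, ρ.1 g (e ((1 : Γ) : Γ ⧸ L)) = e (g : Γ ⧸ L) := by
            intro g
            rw [h]
            simp [cosetRep]
          have h2 : stab ρ.1 (e ((1 : Γ) : Γ ⧸ L)) = L := by
            ext g
            rw [mem_stab, h1, e.injective.eq_iff, eq_comm, QuotientGroup.eq]
            simp
          exact sigma_embedding_ext hS _ _ _ hL _ h2 _ _ h1 _ _ }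
    _ ≃ _ := Equiv.sigmaCongrRight fun L => Equiv.sigmaCongrRight fun e =>
      extensionEquiv S (cosetRep hS L.1 L.2) e

/-- A subgroup of index `k` is a point stabilizer of a representation on `k` points, of which there
are finitely many. -/
lemma finite_subgroupsWith [∀ n, Finite (Γ →* Equiv.Perm (Fin n))] (S : Subgroup Γ → Prop)
    {k : ℕ} (hk : k ≠ 0) : Finite (SubgroupsWith S k) := by
  have key : {L : Subgroup Γ | S L ∧ L.index = k} ⊆
      Set.range (fun t : (Γ →* Equiv.Perm (Fin k)) × Fin k => stab t.1 t.2) := by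
    rintro L ⟨-, rfl⟩
    have hf : Finite (Γ ⧸ L) :=
      @Subgroup.finite_quotient_of_finiteIndex _ _ _ (Subgroup.finiteIndex_iff.2 hk)
    let e : Γ ⧸ L ≃ Fin L.index := Finite.equivFin (Γ ⧸ L)
    refine ⟨⟨e.permCongrHom.toMonoidHom.comp (MulAction.toPermHom Γ (Γ ⧸ L)),
      e ((1 : Γ) : Γ ⧸ L)⟩, ?_⟩
    ext g
    simp only [mem_stab, MonoidHom.comp_apply, MulEquiv.coe_toMonoidHom,
      MulAction.toPermHom_apply, Equiv.permCongrHom_coe, Equiv.permCongr_apply,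
      Equiv.symm_apply_apply, MulAction.toPerm_apply, EmbeddingLike.apply_eq_iff_eq]
    rw [← MulAction.mem_stabilizer_iff, MulAction.stabilizer_quotient]
  exact Set.Finite.subset (Set.finite_range _) key

/-- Grouping the pointed representations by the size `k + 1` of the orbit of the base point. -/
noncomputable def pointedRepEquivByIndex {S : Subgroup Γ → Prop}
    (hS : ∀ L g, S L → S (L.map (MulAut.conj g).toMonoidHom)) (n : ℕ) :
    RepsWith S (Fin n) × Fin n ≃
      Σ k : Fin n, Σ L : SubgroupsWith S (k + 1), Σ e : (Γ ⧸ L.1) ↪ Fin n,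
        RepsWith S {x // ¬ x ∈ Set.range e} :=
  (pointedRepEquiv hS (Fin n)).trans
    { toFun := fun t => ⟨⟨t.1.1.index - 1, by
          have h1 : t.1.1.index ≤ n := by
            simpa [Subgroup.index] using Nat.card_le_card_of_injective _ t.2.1.injective
          have h2 : 0 < n := Fin.pos (t.2.1 ((1 : Γ) : Γ ⧸ t.1.1))
          omega⟩, ⟨t.1.1, t.1.2, by
            have : Finite (Γ ⧸ t.1.1) := Finite.of_injective _ t.2.1.injective
            have : t.1.1.index ≠ 0 := Subgroup.index_ne_zero_of_finite
            simp only []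
            omega⟩, t.2.1, t.2.2⟩
      invFun := fun t => ⟨⟨t.2.1.1, t.2.1.2.1⟩, t.2.2⟩
      left_inv := fun t => rfl
      right_inv := by
        rintro ⟨⟨k, hk⟩, ⟨L, hL, hLk⟩, e, ρ⟩
        simp only at hLk
        obtain rfl : k = L.index - 1 := by omega
        rfl }

/-- The exponential formula, as a recursion. With base point of stabilizer `L` of index `k + 1`, the
falling factorial counts the embeddings of the cosets of `L`, and the last factor the
representations on the complement. -/
theorem mul_repCount [∀ n, Finite (Γ →* Equiv.Perm (Fin n))] {S : Subgroup Γ → Prop}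
    (hS : ∀ L g, S L → S (L.map (MulAut.conj g).toMonoidHom)) (n : ℕ) :
    n * repCount S n = ∑ k ∈ Finset.range n,
      Nat.card (SubgroupsWith S (k + 1)) *
        (n.descFactorial (k + 1) * repCount S (n - (k + 1))) := by
  have h := Nat.card_congr (pointedRepEquivByIndex hS n)
  have hX : ∀ X : Type, [Finite X] → Finite (RepsWith S X) := fun X _ => finite_repsWith S X
  have hs : ∀ k : ℕ, Finite (SubgroupsWith S (k + 1)) := fun k =>
    finite_subgroupsWith S (Nat.succ_ne_zero k)
  have := fun k => Fintype.ofFinite (SubgroupsWith S (k + 1))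
  have hq : ∀ (k : ℕ) (L : SubgroupsWith S (k + 1)), Finite (Γ ⧸ L.1) := fun k L =>
    @Subgroup.finite_quotient_of_finiteIndex _ _ _
      (Subgroup.finiteIndex_iff.2 (by rw [L.2.2]; omega))
  have := fun (k : ℕ) (L : SubgroupsWith S (k + 1)) => Fintype.ofFinite ((Γ ⧸ L.1) ↪ Fin n)
  have := fun (k : ℕ) (L : SubgroupsWith S (k + 1)) => Fintype.ofFinite (Γ ⧸ L.1)
  rw [Nat.card_prod, Nat.card_eq_fintype_card (α := Fin n), Fintype.card_fin, mul_comm,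
    Nat.card_sigma, Fin.sum_univ_eq_sum_range (fun k => Nat.card
      (Σ L : SubgroupsWith S (k + 1), Σ e : (Γ ⧸ L.1) ↪ Fin n,
        RepsWith S {x // ¬ x ∈ Set.range e}))] at h
  rw [repCount, h]
  refine Finset.sum_congr rfl fun k hk => ?_
  have hL : ∀ L : SubgroupsWith S (k + 1), Nat.card (Γ ⧸ L.1) = k + 1 := fun L => L.2.2
  have : ∀ L : SubgroupsWith S (k + 1), Nat.card (Σ e : (Γ ⧸ L.1) ↪ Fin n,
      RepsWith S {x // ¬ x ∈ Set.range e}) =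
        n.descFactorial (k + 1) * repCount S (n - (k + 1)) := by
    intro L
    rw [Nat.card_sigma]
    have hc : ∀ e : (Γ ⧸ L.1) ↪ Fin n, Nat.card (RepsWith S {x // ¬ x ∈ Set.range e}) =
        repCount S (n - (k + 1)) := by
      intro e
      classical
      rw [card_repsWith]
      congr 1
      rw [Nat.card_eq_fintype_card, Fintype.card_subtype_compl, Fintype.card_fin,
        ← Nat.card_eq_fintype_card, ← Nat.card_congr (Equiv.ofInjective e e.injective), hL]
    simp only [hc, Finset.sum_const, Finset.card_univ, smul_eq_mul]
    rw [Fintype.card_embedding_eq, Fintype.card_fin, ← Nat.card_eq_fintype_card, hL]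
  rw [Nat.card_sigma, Finset.sum_congr rfl fun L _ => this L]
  simp only [Finset.sum_const, Finset.card_univ, smul_eq_mul, Nat.card_eq_fintype_card]

lemma repCount_zero (S : Subgroup Γ → Prop) : repCount S 0 = 1 := by
  rw [repCount, Nat.card_eq_one_iff_unique]
  exact ⟨⟨fun a b => by ext g x; exact x.elim0⟩, ⟨1, fun x => x.elim0⟩⟩

/-- The exponential formula for the numbers `repCount S n / n!`: their generating series `F`
satisfies `z F' = F ∑ s(k) zᵏ`, where `s(k)` is the number of subgroups of index `k` that satisfy
`S`. -/
theorem mul_repCount_div_factorial [∀ n, Finite (Γ →* Equiv.Perm (Fin n))]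
    {S : Subgroup Γ → Prop}
    (hS : ∀ L g, S L → S (L.map (MulAut.conj g).toMonoidHom)) (n : ℕ) :
    (n : ℚ) * (repCount S n / (n ! : ℚ)) = ∑ k ∈ Finset.range n,
      (Nat.card (SubgroupsWith S (k + 1)) : ℚ) *
        (repCount S (n - (k + 1)) / ((n - (k + 1)) ! : ℚ)) := by
  rw [← mul_div_assoc, div_eq_iff (by positivity)]
  have h := congrArg (Nat.cast (R := ℚ)) (mul_repCount hS n)
  push_cast at h
  rw [h, Finset.sum_mul]
  refine Finset.sum_congr rfl fun k hk => ?_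
  have hk : k + 1 ≤ n := Finset.mem_range.1 hk
  rw [← Nat.factorial_mul_descFactorial hk]
  push_cast
  have : ((n - (k + 1)) ! : ℚ) ≠ 0 := by positivity
  field_simp

end ExponentialFormula

/-! ### Subgroups of `ℤ × G` -/

section GraphSubgroup

open Subgroup

variable {G : Type} [Group G]

local notation "Zm" => Multiplicative ℤ

/-- The second isomorphism theorem for indices; here `L` need not be normal. -/
lemma relIndex_sup_of_normal {A : Type*} [Group A] (N L : Subgroup A) [N.Normal] :
    L.relIndex (N ⊔ L) = L.relIndex N := by
  symm
  refine Nat.card_congr (Equiv.ofBijective (Quotient.map' (inclusion (le_sup_left : N ≤ N ⊔ L)) ?_)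
    ⟨?_, ?_⟩)
  · intro a b h
    rw [QuotientGroup.leftRel_apply, mem_subgroupOf] at h ⊢
    exact h
  · intro a b
    induction a using QuotientGroup.induction_on with | _ a =>
    induction b using QuotientGroup.induction_on with | _ b =>
    intro h
    have h := Quotient.eq''.1 h
    rw [QuotientGroup.leftRel_apply, mem_subgroupOf] at h
    rw [QuotientGroup.eq, mem_subgroupOf]
    exact h
  · intro a
    induction a using QuotientGroup.induction_on with | _ a =>
    obtain ⟨a, ha⟩ := a
    obtain ⟨n, hn, l, hl, rfl⟩ := mem_sup_of_normal_left.1 ha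
    refine ⟨((⟨n, hn⟩ : N) : N ⧸ L.subgroupOf N), Quotient.eq''.2 ?_⟩
    rw [QuotientGroup.leftRel_apply, mem_subgroupOf]
    simpa using hl

lemma index_prod_eq {A B : Type*} [Group A] [Group B] (L : Subgroup (A × B)) :
    L.index = (L.map (MonoidHom.fst A B)).index * (L.comap (MonoidHom.inr A B)).index := by
  have hr : (MonoidHom.inr A B).range = (MonoidHom.fst A B).ker := by
    ext ⟨a, b⟩
    rw [MonoidHom.mem_ker, MonoidHom.mem_range]
    simp [eq_comm]
  have hn : (MonoidHom.fst A B).range = ⊤ :=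
    MonoidHom.range_eq_top.2 fun a => ⟨(a, 1), rfl⟩
  rw [index_map, index_comap, hr, hn, index_top, mul_one, mul_comm, sup_comm,
    ← relIndex_mul_index (le_sup_right : L ≤ (MonoidHom.fst A B).ker ⊔ L),
    relIndex_sup_of_normal]

lemma mem_zpowers_ofAdd (j : ℕ) (x : Zm) :
    x ∈ zpowers (Multiplicative.ofAdd (j : ℤ)) ↔ (j : ℤ) ∣ x.toAdd := by
  rw [mem_zpowers_iff]
  constructor
  · rintro ⟨k, rfl⟩
    exact ⟨k, by simp [mul_comm]⟩
  · rintro ⟨k, hk⟩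
    exact ⟨k, by rw [← ofAdd_toAdd x, hk, ← ofAdd_zsmul]; simp [mul_comm]⟩

lemma index_zpowers_ofAdd (j : ℕ) : (zpowers (Multiplicative.ofAdd (j : ℤ))).index = j := by
  exact Int.index_zmultiples (j : ℤ)

lemma zpowers_ofAdd_injective :
    Function.Injective fun j : ℕ => zpowers (Multiplicative.ofAdd (j : ℤ)) := by
  intro i j h
  have := congrArg Subgroup.index h
  simpa [index_zpowers_ofAdd] using this

lemma exists_eq_zpowers_ofAdd (H : Subgroup Zm) :
    ∃ j : ℕ, H = zpowers (Multiplicative.ofAdd (j : ℤ)) := by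
  obtain ⟨a, ha⟩ := Int.subgroup_cyclic (Subgroup.toAddSubgroup' H)
  refine ⟨a.natAbs, ?_⟩
  ext x
  have h : x ∈ H ↔ x.toAdd ∈ Subgroup.toAddSubgroup' H := Iff.rfl
  rw [h, ha, mem_zpowers_ofAdd, ← AddSubgroup.zmultiples_eq_closure, Int.mem_zmultiples_iff,
    Int.natAbs_dvd]

/-- This includes the trivial subgroup, whose index is `0` by convention. -/
lemma eq_zpowers_index (H : Subgroup Zm) : H = zpowers (Multiplicative.ofAdd (H.index : ℤ)) := by
  obtain ⟨j, hj⟩ := exists_eq_zpowers_ofAdd H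
  have : H.index = j := by rw [hj, index_zpowers_ofAdd]
  rw [this, ← hj]

/-- The subgroup of `ℤ × G` generated by `K` and `(j, c)`, where `c` normalizes `K`: it consists of
the elements `(j i, cⁱ k)` with `k ∈ K`. -/
def graphSubgroup (K : Subgroup G) (j : ℕ) (c : normalizer (K : Set G)) :
    Subgroup (Zm × G) where
  carrier := {x | ∃ i : ℤ, x.1.toAdd = j * i ∧ (c : G) ^ (-i) * x.2 ∈ K}
  one_mem' := ⟨0, by simp⟩
  mul_mem' := by
    rintro ⟨x, g⟩ ⟨y, h⟩ ⟨i, hi, hg⟩ ⟨k, hk, hh⟩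
    refine ⟨i + k, by simp_all [mul_add], ?_⟩
    have hc : (c : G) ^ (-k) ∈ normalizer (K : Set G) := zpow_mem c.2 _
    have := K.mul_mem ((mem_normalizer_iff.1 hc _).1 hg) hh
    convert this using 1
    simp only [Prod.mk_mul_mk]
    group
  inv_mem' := by
    rintro ⟨x, g⟩ ⟨i, hi, hg⟩
    refine ⟨-i, by simp_all, ?_⟩
    have hc : (c : G) ^ i ∈ normalizer (K : Set G) := zpow_mem c.2 _
    have := (mem_normalizer_iff.1 hc _).1 (K.inv_mem hg)
    convert this using 1
    simp only [Prod.inv_mk]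
    group

lemma mem_graphSubgroup {K : Subgroup G} {j : ℕ} {c : normalizer (K : Set G)} {x : Zm × G} :
    x ∈ graphSubgroup K j c ↔ ∃ i : ℤ, x.1.toAdd = j * i ∧ (c : G) ^ (-i) * x.2 ∈ K := Iff.rfl

variable {K : Subgroup G} {j : ℕ}

lemma map_fst_graphSubgroup (c : normalizer (K : Set G)) :
    (graphSubgroup K j c).map (MonoidHom.fst _ _) = zpowers (Multiplicative.ofAdd (j : ℤ)) := by
  ext x
  rw [mem_zpowers_ofAdd]
  constructor
  · rintro ⟨⟨y, g⟩, ⟨i, hi, hg⟩, rfl⟩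
    exact ⟨i, hi⟩
  · rintro ⟨i, hi⟩
    exact ⟨(x, (c : G) ^ i), ⟨i, hi, by simp⟩, rfl⟩

lemma comap_inr_graphSubgroup (hj : j ≠ 0) (c : normalizer (K : Set G)) :
    (graphSubgroup K j c).comap (MonoidHom.inr _ _) = K := by
  ext g
  simp only [mem_comap, mem_graphSubgroup, MonoidHom.inr_apply, toAdd_one]
  constructor
  · rintro ⟨i, hi, hg⟩
    obtain rfl : i = 0 := by simpa [hj] using hi.symm
    simpa using hg
  · exact fun hg => ⟨0, by simpa using hg⟩

lemma index_graphSubgroup (hj : j ≠ 0) (c : normalizer (K : Set G)) :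
    (graphSubgroup K j c).index = j * K.index := by
  rw [index_prod_eq, map_fst_graphSubgroup, comap_inr_graphSubgroup hj, index_zpowers_ofAdd]

lemma mem_graphSubgroup_inl (c : normalizer (K : Set G)) (x : Zm) :
    (x, (1 : G)) ∈ graphSubgroup K j c ↔ ∃ i : ℤ, x.toAdd = j * i ∧ (c : G) ^ i ∈ K := by
  rw [mem_graphSubgroup]
  simp [zpow_neg]

lemma graphSubgroup_eq_iff (hj : j ≠ 0) (c c' : normalizer (K : Set G)) :
    graphSubgroup K j c = graphSubgroup K j c' ↔ (c : G)⁻¹ * c' ∈ K := by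
  constructor
  · intro h
    have : (Multiplicative.ofAdd (j : ℤ), (c' : G)) ∈ graphSubgroup K j c := by
      rw [h]; exact ⟨1, by simp⟩
    obtain ⟨i, hi, hg⟩ := this
    obtain rfl : i = 1 := by
      have : (j : ℤ) * i = j * 1 := by simpa using hi.symm
      exact mul_left_cancel₀ (by exact_mod_cast hj) this
    simpa using hg
  · intro h
    -- `c` and `c'` have the same image in the quotient group of the normalizer by `K`.
    have hq : ∀ i : ℤ, (c : G) ^ (-i) * (c' : G) ^ i ∈ K := by
      intro i
      have h1 : ((c : normalizer (K : Set G)) : normalizer (K : Set G) ⧸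
          K.subgroupOf (normalizer (K : Set G))) = c' := by
        rw [QuotientGroup.eq, mem_subgroupOf]
        simpa using h
      have h2 : ((c ^ i : normalizer (K : Set G)) : normalizer (K : Set G) ⧸
          K.subgroupOf (normalizer (K : Set G))) = (c' ^ i : normalizer (K : Set G)) := by
        rw [QuotientGroup.mk_zpow, QuotientGroup.mk_zpow, h1]
      rw [QuotientGroup.eq, mem_subgroupOf] at h2
      simpa [zpow_neg] using h2
    ext ⟨x, g⟩
    simp only [mem_graphSubgroup]
    refine exists_congr fun i => and_congr_right fun _ => ?_
    rw [← K.mul_mem_cancel_left (inv_mem (hq i))]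
    simp [mul_assoc]

lemma exists_eq_graphSubgroup (L : Subgroup (Zm × G))
    (h1 : L.map (MonoidHom.fst _ _) = zpowers (Multiplicative.ofAdd (j : ℤ)))
    (h2 : L.comap (MonoidHom.inr _ _) = K) :
    ∃ c : normalizer (K : Set G), graphSubgroup K j c = L := by
  have h3 : Multiplicative.ofAdd (j : ℤ) ∈ L.map (MonoidHom.fst _ _) := by
    rw [h1]; exact mem_zpowers _
  obtain ⟨⟨z, c⟩, hc, rfl⟩ := h3
  have hK : ∀ g, g ∈ K ↔ ((1 : Zm), g) ∈ L := fun g => by rw [← h2]; rfl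
  have hcN : c ∈ normalizer (K : Set G) := by
    rw [mem_normalizer_iff]
    intro g
    rw [hK, hK, ← L.mul_mem_cancel_left hc, ← L.mul_mem_cancel_right (inv_mem hc)]
    simp
  refine ⟨⟨c, hcN⟩, ?_⟩
  have hmem : ∀ (i : ℤ) (x : Zm) (g : G), x.toAdd = j * i →
      (c ^ (-i) * g ∈ K ↔ (x, g) ∈ L) := by
    intro i x g hx
    rw [hK, ← L.mul_mem_cancel_left (zpow_mem hc i)]
    have : x = Multiplicative.ofAdd (j : ℤ) ^ i := by
      rw [← ofAdd_toAdd x, hx, ← ofAdd_zsmul]; simp [mul_comm]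
    simp [this]
  ext ⟨x, g⟩
  rw [mem_graphSubgroup]
  constructor
  · rintro ⟨i, hi, hg⟩
    exact (hmem i x g hi).1 hg
  · intro hx
    have : x ∈ zpowers (Multiplicative.ofAdd (j : ℤ)) := by
      rw [← h1]; exact ⟨_, hx, rfl⟩
    obtain ⟨i, hi⟩ := (mem_zpowers_ofAdd j x).1 this
    exact ⟨i, hi, (hmem i x g hi).2 hx⟩

/-- The subgroups of `ℤ × G` with projection `jℤ` to `ℤ` and intersection `K` with `G` correspond to
the elements of `N(K) / K`. -/
lemma card_subgroups_with_fst_inr (hj : j ≠ 0) :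
    Nat.card {L : Subgroup (Zm × G) //
      L.map (MonoidHom.fst _ _) = zpowers (Multiplicative.ofAdd (j : ℤ)) ∧
      L.comap (MonoidHom.inr _ _) = K} = K.relIndex (normalizer (K : Set G)) := by
  symm
  refine Nat.card_congr (Equiv.ofBijective (Quotient.lift
    (fun c => ⟨graphSubgroup K j c, map_fst_graphSubgroup c, comap_inr_graphSubgroup hj c⟩) ?_)
    ⟨?_, ?_⟩)
  · intro c c' h
    rw [Subtype.mk.injEq, graphSubgroup_eq_iff hj]
    have h := QuotientGroup.leftRel_apply.1 h
    rw [mem_subgroupOf] at h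
    simpa using h
  · intro a b
    induction a using QuotientGroup.induction_on with | _ a =>
    induction b using QuotientGroup.induction_on with | _ b =>
    intro h
    have h := (graphSubgroup_eq_iff hj a b).1 (Subtype.mk.inj h)
    rw [QuotientGroup.eq, mem_subgroupOf]
    simpa using h
  · rintro ⟨L, h1, h2⟩
    obtain ⟨c, hc⟩ := exists_eq_graphSubgroup L h1 h2
    exact ⟨(c : _ ⧸ _), Subtype.ext hc⟩

end GraphSubgroup

/-! ### Subgroups of `ℤ × G` of given index -/

section ProdCond

open Subgroup

variable {G : Type} [Group G]

local notation "Zm" => Multiplicative ℤ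

/-- The condition on `L ≤ ℤ × G` that `L ∩ ℤ = mℤ` and that `L ∩ G` satisfies `S`. -/
def ProdCond (S : Subgroup G → Prop) (m : ℕ) (L : Subgroup (Zm × G)) : Prop :=
  L.comap (MonoidHom.inl _ _) = zpowers (Multiplicative.ofAdd (m : ℤ)) ∧
    S (L.comap (MonoidHom.inr _ _))

lemma dvd_of_prodCond {S : Subgroup G → Prop} {m n : ℕ}
    (L : SubgroupsWith (ProdCond S m) n) : m ∣ n := by
  have hr : (MonoidHom.inl Zm G).range = (MonoidHom.snd Zm G).ker := by
    ext ⟨a, b⟩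
    rw [MonoidHom.mem_ker, MonoidHom.mem_range]
    simp [eq_comm]
  have h : (L.1.comap (MonoidHom.inl Zm G)).index ∣ L.1.index := by
    rw [index_comap, hr, ← relIndex_sup_of_normal]
    exact Dvd.intro _ (relIndex_mul_index le_sup_right)
  rwa [L.2.1.1, index_zpowers_ofAdd, L.2.2] at h

lemma card_prodCond_of_not_dvd (S : Subgroup G → Prop) {m n : ℕ} (h : ¬ m ∣ n) :
    Nat.card (SubgroupsWith (ProdCond S m) n) = 0 := by
  have : IsEmpty (SubgroupsWith (ProdCond S m) n) := ⟨fun L => h (dvd_of_prodCond L)⟩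
  exact Nat.card_of_isEmpty

lemma prodCond_conj {S : Subgroup G → Prop}
    (hS : ∀ L g, S L → S (L.map (MulAut.conj g).toMonoidHom)) (m : ℕ) (L : Subgroup (Zm × G))
    (g : Zm × G) (h : ProdCond S m L) : ProdCond S m (L.map (MulAut.conj g).toMonoidHom) := by
  have hm : ∀ x, x ∈ L.map (MulAut.conj g).toMonoidHom ↔ g⁻¹ * x * g ∈ L := by
    intro x
    constructor
    · rintro ⟨y, hy, rfl⟩
      simpa [mul_assoc] using hy
    · intro hx
      exact ⟨_, hx, by simp [mul_assoc]⟩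
  obtain ⟨z, c⟩ := g
  constructor
  · rw [← h.1]
    ext x
    rw [mem_comap, mem_comap, hm]
    simp
  · convert hS _ c h.2
    ext x
    rw [mem_comap, hm]
    constructor
    · intro hx
      exact ⟨c⁻¹ * x * c, by simpa using hx, by simp [mul_assoc]⟩
    · rintro ⟨y, hy, rfl⟩
      simpa [mul_assoc] using hy

/-- Every subgroup of finite index of `ℤ × G` meets `ℤ` in `mℤ` for exactly one `m`. -/
lemma sum_card_prodCond (S : Subgroup G → Prop) {n : ℕ} (hn : n ≠ 0)
    [∀ m, Finite (SubgroupsWith (ProdCond S m) n)] :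
    ∑ m ∈ n.divisors, Nat.card (SubgroupsWith (ProdCond S m) n) =
      Nat.card
        (SubgroupsWith (fun L : Subgroup (Zm × G) => S (L.comap (MonoidHom.inr _ _))) n) := by
  rw [← Finset.sum_coe_sort, ← Nat.card_sigma]
  refine Nat.card_congr (Equiv.ofBijective (fun t => ⟨t.2.1, t.2.2.1.2, t.2.2.2⟩) ⟨?_, ?_⟩)
  · rintro ⟨⟨m, hm⟩, L, hL, hLn⟩ ⟨⟨m', hm'⟩, L', hL', hLn'⟩ h
    obtain rfl : L = L' := congrArg Subtype.val h
    obtain rfl : m = m' := zpowers_ofAdd_injective (hL.1.symm.trans hL'.1)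
    rfl
  · rintro ⟨L, hL, hLn⟩
    have hP : ProdCond S (L.comap (MonoidHom.inl _ _)).index L := ⟨eq_zpowers_index _, hL⟩
    exact ⟨⟨⟨_, Nat.mem_divisors.2 ⟨dvd_of_prodCond ⟨L, hP, hLn⟩, hn⟩⟩, ⟨L, hP, hLn⟩⟩, rfl⟩

/-- Subgroups of index `n` of `ℤ × G`, sorted by their intersection with `G`. -/
lemma card_subgroupsWith_prod (S : Subgroup G → Prop) {n : ℕ} (hn : n ≠ 0)
    [Finite (SubgroupsWith (fun L : Subgroup (Zm × G) => S (L.comap (MonoidHom.inr _ _))) n)]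
    (hfin : ∀ d, d ≠ 0 → Finite (SubgroupsWith S d)) :
    Nat.card (SubgroupsWith (fun L : Subgroup (Zm × G) => S (L.comap (MonoidHom.inr _ _))) n) =
      ∑ d ∈ n.divisors, ∑ᶠ K : SubgroupsWith S d, K.1.relIndex (normalizer (K.1 : Set G)) := by
  have hd : ∀ d ∈ n.divisors, n / d ≠ 0 := fun d hd =>
    (Nat.div_pos (Nat.divisor_le hd) (Nat.pos_of_mem_divisors hd)).ne'
  let B : n.divisors → Type := fun d => Σ K : SubgroupsWith S d, {L : Subgroup (Zm × G) //
        L.map (MonoidHom.fst _ _) = zpowers (Multiplicative.ofAdd ((n / d.1 : ℕ) : ℤ)) ∧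
        L.comap (MonoidHom.inr _ _) = K.1}
  let f : (Σ d, B d) →
      SubgroupsWith (fun L : Subgroup (Zm × G) => S (L.comap (MonoidHom.inr _ _))) n :=
    fun t => ⟨t.2.2.1, by beta_reduce; rw [t.2.2.2.2]; exact t.2.1.2.1, by
        rw [index_prod_eq, t.2.2.2.1, t.2.2.2.2, t.2.1.2.2, index_zpowers_ofAdd]
        exact Nat.div_mul_cancel (Nat.dvd_of_mem_divisors t.1.2)⟩
  have hf : Function.Bijective f := by
    constructor
    · rintro ⟨⟨d, hd⟩, ⟨K, hK, hKd⟩, ⟨L, h1, h2⟩⟩ ⟨⟨d', hd'⟩, ⟨K', hK', hKd'⟩, ⟨L', h1', h2'⟩⟩ h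
      obtain rfl : L = L' := congrArg Subtype.val h
      obtain rfl : K = K' := h2.symm.trans h2'
      obtain rfl : d = d' := hKd.symm.trans hKd'
      rfl
    · rintro ⟨L, hL, hLn⟩
      have h := index_prod_eq L
      rw [hLn] at h
      obtain ⟨K, hK⟩ : ∃ K, L.comap (MonoidHom.inr Zm G) = K := ⟨_, rfl⟩
      obtain ⟨d, hKd⟩ : ∃ d, K.index = d := ⟨_, rfl⟩
      rw [hK] at hL h
      rw [hKd] at h
      have h0 : d ≠ 0 := fun h0 => hn (by simpa [h0] using h)
      have h1 : d ∈ n.divisors := Nat.mem_divisors.2 ⟨Dvd.intro_left _ h.symm, hn⟩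
      have h2 : L.map (MonoidHom.fst _ _) = zpowers (Multiplicative.ofAdd ((n / d : ℕ) : ℤ)) := by
        rw [Nat.div_eq_of_eq_mul_left (Nat.pos_of_ne_zero h0) h]
        exact eq_zpowers_index _
      exact ⟨⟨⟨d, h1⟩, ⟨⟨K, hL, hKd⟩, ⟨L, h2, hK⟩⟩⟩, Subtype.ext rfl⟩
  have e := Equiv.ofBijective f hf
  have hB := Finite.of_equiv _ e.symm
  have hB1 : ∀ d, Finite (B d) := fun d =>
    Finite.of_injective (fun b => (⟨d, b⟩ : Σ d, B d)) sigma_mk_injective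
  rw [← Nat.card_congr e, Nat.card_sigma, ← Finset.sum_coe_sort n.divisors
    (fun d => ∑ᶠ K : SubgroupsWith S d, K.1.relIndex (normalizer (K.1 : Set G)))]
  refine Finset.sum_congr rfl fun d _ => ?_
  obtain ⟨d, hdn⟩ := d
  have := hfin d (Nat.pos_of_mem_divisors hdn).ne'
  have := Fintype.ofFinite (SubgroupsWith S d)
  have hB2 : ∀ K : SubgroupsWith S d, Finite {L : Subgroup (Zm × G) //
        L.map (MonoidHom.fst _ _) = zpowers (Multiplicative.ofAdd ((n / d : ℕ) : ℤ)) ∧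
        L.comap (MonoidHom.inr _ _) = K.1} := fun K => by
    have := hB1 ⟨d, hdn⟩
    exact Finite.of_injective (fun L => (⟨K, L⟩ : B ⟨d, hdn⟩))
      fun a b h => eq_of_heq (Sigma.mk.inj h).2
  rw [finsum_eq_sum_of_fintype, Nat.card_sigma]
  exact Finset.sum_congr rfl fun K _ => card_subgroups_with_fst_inr (hd d hdn)

/-- The conjugacy class of `K` has as many elements as the normalizer of `K` has cosets. -/
lemma index_normalizer_eq_card {n : ℕ} (K : FreeSubgroupOfIndex G n) :
    (normalizer (K.1 : Set G)).index =
      Nat.card {K' // Quotient.mk (freeSubgroupSetoid G n) K' =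
        Quotient.mk (freeSubgroupSetoid G n) K} := by
  have hmm : ∀ a b : G, (K.1.map (MulAut.conj a).toMonoidHom).map (MulAut.conj b).toMonoidHom =
      K.1.map (MulAut.conj (b * a)).toMonoidHom := by
    intro a b
    rw [map_map]
    congr 1
    ext x
    simp [mul_assoc]
  have h1 : ∀ a b : G, a⁻¹ * b ∈ normalizer (K.1 : Set G) ↔
      K.1.map (MulAut.conj a).toMonoidHom = K.1.map (MulAut.conj b).toMonoidHom := by
    intro a b
    have hm : a⁻¹ * b ∈ normalizer (K.1 : Set G) ↔
        K.1.map (MulAut.conj (a⁻¹ * b)).toMonoidHom = K.1 := mem_normalizer_iff_map_conj_eq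
    have hb := hmm (a⁻¹ * b) a
    rw [mul_inv_cancel_left] at hb
    rw [hm, ← hb, (map_injective (f := (MulAut.conj a).toMonoidHom)
      (MulAut.conj a).injective).eq_iff, eq_comm]
  have hfree : ∀ g : G, IsFreeGroup (K.1.map (MulAut.conj g).toMonoidHom) ∧
      (K.1.map (MulAut.conj g).toMonoidHom).FiniteIndex ∧
      (K.1.map (MulAut.conj g).toMonoidHom).index = n := by
    intro g
    have hi : (K.1.map (MulAut.conj g).toMonoidHom).index = n :=
      (index_map_equiv K.1 (MulAut.conj g)).trans K.2.2.2
    have := K.2.1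
    refine ⟨IsFreeGroup.ofMulEquiv (K.1.equivMapOfInjective _ (MulAut.conj g).injective), ?_, hi⟩
    rw [finiteIndex_iff, hi, ← K.2.2.2, ← finiteIndex_iff]
    exact K.2.2.1
  refine Nat.card_congr (Equiv.ofBijective (Quotient.lift
    (fun g => ⟨⟨K.1.map (MulAut.conj g).toMonoidHom, hfree g⟩,
      Quotient.sound ((freeSubgroupSetoid G n).symm ⟨g, rfl⟩)⟩) ?_) ⟨?_, ?_⟩)
  · intro a b h
    have h := (h1 a b).1 (QuotientGroup.leftRel_apply.1 h)
    simp only [h]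
  · intro a b
    induction a using QuotientGroup.induction_on with | _ a =>
    induction b using QuotientGroup.induction_on with | _ b =>
    intro h
    rw [QuotientGroup.eq, h1]
    exact congrArg (fun x => x.1.1) h
  · rintro ⟨K', hK'⟩
    obtain ⟨g, hg⟩ := Quotient.exact hK'.symm
    exact ⟨(g : G ⧸ _), Subtype.ext (Subtype.ext hg.symm)⟩

/-- Orbit counting for the conjugation action: the class of `K` has `n / [N(K) : K]` elements, so
that each class contributes `n` to the sum. -/
lemma sum_relIndex_normalizer {n : ℕ} (hn : n ≠ 0) [Fintype (FreeSubgroupOfIndex G n)] :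
    ∑ K : FreeSubgroupOfIndex G n, K.1.relIndex (normalizer (K.1 : Set G)) =
      n * Nat.card (FreeSubgroupConjClass G n) := by
  classical
  rw [← Fintype.sum_fiberwise (fun K => Quotient.mk (freeSubgroupSetoid G n) K),
    Nat.card_eq_fintype_card, mul_comm, ← smul_eq_mul, ← Finset.card_univ, ← Finset.sum_const]
  refine Finset.sum_congr rfl fun ω _ => ?_
  obtain ⟨K, rfl⟩ := Quotient.exists_rep ω
  have h : ∀ K' : FreeSubgroupOfIndex G n, Quotient.mk (freeSubgroupSetoid G n) K' =
      Quotient.mk (freeSubgroupSetoid G n) K → K'.1.relIndex (normalizer (K'.1 : Set G)) *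
      Nat.card {K' // Quotient.mk (freeSubgroupSetoid G n) K' =
        Quotient.mk (freeSubgroupSetoid G n) K} = n := by
    intro K' hK'
    rw [← hK', ← index_normalizer_eq_card, relIndex_mul_index le_normalizer, K'.2.2.2]
  have h0 := h K rfl
  have hpos : 0 < Nat.card {K' // Quotient.mk (freeSubgroupSetoid G n) K' =
        Quotient.mk (freeSubgroupSetoid G n) K} := by
    rw [Nat.pos_iff_ne_zero]
    intro h1
    rw [h1] at h0
    exact hn (by simpa using h0.symm)
  rw [Finset.sum_congr rfl (g := fun _ => K.1.relIndex (normalizer (K.1 : Set G)))]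
  · rw [Finset.sum_const, Finset.card_univ, ← Nat.card_eq_fintype_card, smul_eq_mul, mul_comm, h0]
  · rintro ⟨K', hK'⟩ _
    exact Nat.eq_of_mul_eq_mul_right hpos ((h K' hK').trans h0.symm)

end ProdCond

section CountProdInt

open Subgroup

local notation "Zm" => Multiplicative ℤ

/-- Subgroups of index `n` of `ℤ × G` with free intersection with `G`, counted by the conjugacy
classes of these intersections. -/
theorem card_subgroupsWith_free {G : Type} [Group G] {n : ℕ} (hn : n ≠ 0)
    [Finite (SubgroupsWith
      (fun L : Subgroup (Zm × G) => IsFreeGroup (L.comap (MonoidHom.inr _ _))) n)]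
    (hfin : ∀ d, d ≠ 0 → Finite (SubgroupsWith (fun K : Subgroup G => IsFreeGroup K) d)) :
    Nat.card (SubgroupsWith
      (fun L : Subgroup (Zm × G) => IsFreeGroup (L.comap (MonoidHom.inr _ _))) n) =
      ∑ d ∈ n.divisors, d * Nat.card (FreeSubgroupConjClass G d) := by
  rw [card_subgroupsWith_prod (fun K : Subgroup G => IsFreeGroup K) hn hfin]
  refine Finset.sum_congr rfl fun d hd => ?_
  have hd0 := (Nat.pos_of_mem_divisors hd).ne'
  let e : FreeSubgroupOfIndex G d ≃ SubgroupsWith (fun K : Subgroup G => IsFreeGroup K) d :=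
    Equiv.subtypeEquivRight fun K => and_congr_right fun _ =>
      ⟨fun h => h.2, fun h => ⟨finiteIndex_iff.2 (h ▸ hd0), h⟩⟩
  have := hfin d hd0
  have := Finite.of_equiv _ e.symm
  have := Fintype.ofFinite (FreeSubgroupOfIndex G d)
  rw [← sum_relIndex_normalizer hd0, ← finsum_eq_sum_of_fintype,
    ← finsum_comp_equiv e]
  rfl

section Comm

variable {C : Type} [CommGroup C]

/-- In `ℤ × C`, the subgroup generated by `(j, c)` meets `ℤ` in the multiples of `j · ord c`. -/
lemma comap_inl_graphSubgroup_bot (j : ℕ) (c : normalizer ((⊥ : Subgroup C) : Set C)) :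
    (graphSubgroup ⊥ j c).comap (MonoidHom.inl _ _) =
      zpowers (Multiplicative.ofAdd ((j * orderOf (c : C) : ℕ) : ℤ)) := by
  ext x
  rw [mem_comap, MonoidHom.inl_apply, mem_graphSubgroup_inl, mem_zpowers_ofAdd]
  simp only [mem_bot, ← orderOf_dvd_iff_zpow_eq_one]
  push_cast
  constructor
  · rintro ⟨i, hi, k, hk⟩
    exact ⟨k, by rw [hi, hk, mul_assoc]⟩
  · rintro ⟨k, hk⟩
    exact ⟨orderOf (c : C) * k, by rw [hk, mul_assoc], dvd_mul_right _ _⟩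

lemma mem_normalizer_bot (c : C) : c ∈ normalizer ((⊥ : Subgroup C) : Set C) := by
  rw [mem_normalizer_iff]; simp

/-- The subgroup generated by `(j, c)` has index `j |C|` and meets `ℤ` in `j · ord c`, whence
`j = m / ord c` and `ord c · i = |C|`. -/
lemma card_prodCond_bot_eq_card_orderOf [Finite C] {m : ℕ} (hm : m ≠ 0) (i : ℕ) :
    Nat.card (SubgroupsWith (ProdCond (fun K : Subgroup C => K = ⊥) m) (m * i)) =
      Nat.card {c : C // orderOf c * i = Nat.card C ∧ orderOf c ∣ m} := by
  symm
  have hj : ∀ c : {c : C // orderOf c * i = Nat.card C ∧ orderOf c ∣ m},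
      m / orderOf c.1 ≠ 0 := fun c =>
    (Nat.div_pos (Nat.le_of_dvd (Nat.pos_of_ne_zero hm) c.2.2) (orderOf_pos _)).ne'
  refine Nat.card_congr (Equiv.ofBijective (fun c =>
    ⟨graphSubgroup ⊥ (m / orderOf c.1) ⟨c.1, mem_normalizer_bot c.1⟩, ⟨?_, ?_⟩, ?_⟩) ⟨?_, ?_⟩)
  · rw [comap_inl_graphSubgroup_bot, Nat.div_mul_cancel c.2.2]
  · exact comap_inr_graphSubgroup (hj c) _
  · rw [index_graphSubgroup (hj c), index_bot]
    refine (congrArg (m / orderOf c.1 * ·) c.2.1.symm).trans ?_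
    rw [← mul_assoc, Nat.div_mul_cancel c.2.2]
  · intro c c' h
    have h := congrArg Subtype.val h
    simp only at h
    have h1 : m / orderOf c.1 = m / orderOf c'.1 := by
      apply zpowers_ofAdd_injective
      have h2 := congrArg (Subgroup.map (MonoidHom.fst Zm C)) h
      rwa [map_fst_graphSubgroup, map_fst_graphSubgroup] at h2
    rw [← h1, graphSubgroup_eq_iff (hj c), mem_bot, inv_mul_eq_one] at h
    exact Subtype.ext h
  · rintro ⟨L, ⟨h1, h2⟩, h3⟩
    obtain ⟨j, h4⟩ := exists_eq_zpowers_ofAdd (L.map (MonoidHom.fst _ _))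
    obtain ⟨⟨c, hc⟩, h5⟩ := exists_eq_graphSubgroup L h4 h2
    have h6 := index_prod_eq L
    rw [h3, h2, h4, index_zpowers_ofAdd, index_bot] at h6
    have h7 : m = j * orderOf c := by
      apply zpowers_ofAdd_injective
      exact h1.symm.trans (by rw [← h5, comap_inl_graphSubgroup_bot])
    have hj0 : 0 < j := Nat.pos_of_ne_zero (by rintro rfl; simp at h7; exact hm h7)
    have h8 : m / orderOf c = j := Nat.div_eq_of_eq_mul_left (orderOf_pos c) h7
    refine ⟨⟨c, ?_, ?_⟩, Subtype.ext ?_⟩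
    · apply Nat.eq_of_mul_eq_mul_left hj0
      rw [← h6, ← mul_assoc, ← h7]
    · rw [h7]; exact dvd_mul_left _ _
    · simp only [h8]
      exact h5

/-- For a cyclic group `C`, the number of subgroups of `ℤ × C` of index `m i` that meet `C`
trivially and `ℤ` in `mℤ`. -/
theorem card_prodCond_bot [Finite C] [IsCyclic C] {m i : ℕ} (hm : m ≠ 0) :
    Nat.card (SubgroupsWith (ProdCond (fun K : Subgroup C => K = ⊥) m) (m * i)) =
      ∑ d ∈ (Nat.gcd m (Nat.card C)).divisors, if Nat.card C / d = i then φ d else 0 := by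
  have := Fintype.ofFinite C
  classical
  have hp : Nat.card C ≠ 0 := Nat.card_pos.ne'
  rw [card_prodCond_bot_eq_card_orderOf hm, Nat.card_eq_fintype_card, Fintype.card_subtype]
  have hmaps : ∀ c ∈ Finset.univ.filter (fun c : C => orderOf c * i = Nat.card C ∧ orderOf c ∣ m),
      orderOf c ∈ (Nat.gcd m (Nat.card C)).divisors := by
    intro c hc
    simp only [Finset.mem_filter] at hc
    exact Nat.mem_divisors.2 ⟨Nat.dvd_gcd hc.2.2 (Dvd.intro _ hc.2.1),
      Nat.gcd_ne_zero_left hm⟩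
  rw [Finset.card_eq_sum_card_fiberwise hmaps]
  refine Finset.sum_congr rfl fun d hd => ?_
  have hdm := (Nat.dvd_of_mem_divisors hd).trans (Nat.gcd_dvd_left _ _)
  have hdp := (Nat.dvd_of_mem_divisors hd).trans (Nat.gcd_dvd_right _ _)
  have hd0 := Nat.pos_of_mem_divisors hd
  split_ifs with h
  · rw [← IsCyclic.card_orderOf_eq_totient (α := C) (by rwa [← Nat.card_eq_fintype_card])]
    congr 1
    ext c
    simp only [Finset.mem_filter, Finset.mem_univ, true_and]
    constructor
    · exact fun hc => hc.2
    · rintro rfl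
      exact ⟨⟨by rw [← h, Nat.mul_div_cancel' hdp], hdm⟩, rfl⟩
  · rw [Finset.card_eq_zero, Finset.filter_eq_empty_iff]
    intro c hc hcd
    simp only [Finset.mem_filter, Finset.mem_univ, true_and] at hc
    apply h
    rw [← hc.1, hcd, Nat.mul_div_cancel_left _ hd0]

end Comm

end CountProdInt

/-! ### Free subgroups of `A * ℤ` -/

section Free

open CategoryTheory CategoryTheory.ActionCategory Monoid

variable {A : Type} [Group A]

local notation "Zm" => Multiplicative ℤ

/-- The generator of the infinite cyclic factor of `A * ℤ`. -/
def coprodGen (A : Type) [Group A] : Coprod A Zm := Coprod.inr (Multiplicative.ofAdd 1)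

variable {X : Type} [MulAction (Coprod A Zm) X]

/-- For an action of `A * ℤ` on `X`: a choice of a representative `rep x` in the `A`-orbit of each
point `x`, and of an element `tr x` of `A` that moves `rep x` to `x`. -/
structure OrbitTransversal (A X : Type) [Group A] [MulAction (Coprod A Zm) X] where
  rep : X → X
  tr : X → A
  tr_smul : ∀ x, (Coprod.inl (tr x) : Coprod A Zm) • rep x = x
  rep_smul : ∀ (g : A) x, rep ((Coprod.inl g : Coprod A Zm) • x) = rep x

lemma nonempty_orbitTransversal : Nonempty (OrbitTransversal A X) := by
  let _ : MulAction A X := MulAction.compHom X (Coprod.inl : A →* Coprod A Zm)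
  have h : ∀ x : X, ∃ g : A, g • (Quotient.mk (MulAction.orbitRel A X) x).out = x := by
    intro x
    have := (Quotient.mk_out (s := MulAction.orbitRel A X) x)
    exact ((MulAction.orbitRel A X).symm this)
  choose t ht using h
  refine ⟨⟨fun x => (Quotient.mk (MulAction.orbitRel A X) x).out, t, ht, fun g x => ?_⟩⟩
  have : Quotient.mk (MulAction.orbitRel A X) ((Coprod.inl g : Coprod A Zm) • x) =
      Quotient.mk (MulAction.orbitRel A X) x := Quotient.sound ⟨g, rfl⟩
  rw [this]

namespace OrbitTransversal

variable (T : OrbitTransversal A X)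

lemma rep_rep (x : X) : T.rep (T.rep x) = T.rep x := by
  conv_rhs => rw [← T.tr_smul x, T.rep_smul]

lemma tr_eq_one (hfree : ∀ (g : A) (x : X), (Coprod.inl g : Coprod A Zm) • x = x → g = 1)
    {x : X} (hx : x = T.rep x) : T.tr x = 1 := by
  apply hfree _ x
  conv_lhs => rw [hx, ← hx]
  conv_rhs => rw [← T.tr_smul x, ← hx]

lemma tr_smul_eq (hfree : ∀ (g : A) (x : X), (Coprod.inl g : Coprod A Zm) • x = x → g = 1)
    (g : A) (x : X) : T.tr ((Coprod.inl g : Coprod A Zm) • x) = g * T.tr x := by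
  have h1 := T.tr_smul ((Coprod.inl g : Coprod A Zm) • x)
  rw [T.rep_smul] at h1
  have h2 : (Coprod.inl (g * T.tr x) : Coprod A Zm) • T.rep x =
      (Coprod.inl g : Coprod A Zm) • x := by
    rw [map_mul, mul_smul, T.tr_smul]
  generalize T.tr ((Coprod.inl g : Coprod A Zm) • x) = w at h1 ⊢
  rw [← mul_inv_eq_one]
  apply hfree _ ((Coprod.inl g : Coprod A Zm) • x)
  rw [← h2, map_mul, mul_smul, map_inv, inv_smul_smul, h1, h2]

end OrbitTransversal

/-- The action groupoid of an action of `A * ℤ` in which `A` acts freely is a free groupoid: its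
generating arrows are those of the generator of `ℤ` and, in every `A`-orbit, the arrows from the
representative to the other points. A functor to a group is a homomorphism from `A * ℤ` to a
semidirect product, by `CategoryTheory.ActionCategory.uncurry`; given labels of the generating
arrows, it is defined on `A` as the coboundary of the labels `τ` of the star-shaped trees, and on
the generator of `ℤ` by the labels `β`. -/
@[reducible] noncomputable def actionGroupoidIsFreeOfFree
    (hfree : ∀ (g : A) (x : X), (Coprod.inl g : Coprod A Zm) • x = x → g = 1)
    (T : OrbitTransversal A X) : IsFreeGroupoid (ActionCategory (Coprod A Zm) X) where
  quiverGenerators :=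
    ⟨fun a b => PLift (coprodGen A • a.back = b.back) ⊕
      PLift (a.back = T.rep b.back ∧ ¬ b.back = T.rep b.back)⟩
  of := fun {a b} e => match e with
    | Sum.inl h => ⟨coprodGen A, h.down⟩
    | Sum.inr h => ⟨Coprod.inl (T.tr b.back), by
        have := T.tr_smul b.back
        rw [← h.down.1] at this
        exact this⟩
  unique_lift := by
    classical
    intro H _ f
    let β : X → H := fun b => @f ⟨(), _⟩ ⟨(), b⟩ (Sum.inl ⟨smul_inv_smul (coprodGen A) b⟩)
    let τ : X → H := fun b => if h : b = T.rep b then 1 else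
      @f ⟨(), T.rep b⟩ ⟨(), b⟩ (Sum.inr ⟨rfl, h⟩)
    let F' : Coprod A Zm →* (X → H) ⋊[mulAutArrow] (Coprod A Zm) := Coprod.lift
      ((MulAut.conj (SemidirectProduct.inl τ)).toMonoidHom.comp
        (SemidirectProduct.inr.comp Coprod.inl))
      (zpowersHom _ ⟨β, coprodGen A⟩)
    have hF1 : ∀ g b, (F' (Coprod.inl g)).left b =
        τ b * (τ ((Coprod.inl g : Coprod A Zm)⁻¹ • b))⁻¹ := by
      intro g b
      simp only [F', Coprod.lift_apply_inl, MonoidHom.comp_apply, MulEquiv.coe_toMonoidHom,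
        MulAut.conj_apply, SemidirectProduct.mul_left, SemidirectProduct.left_inl,
        SemidirectProduct.right_inl, SemidirectProduct.left_inr, map_one, mul_one,
        SemidirectProduct.mul_right, SemidirectProduct.right_inr, one_mul,
        SemidirectProduct.inv_left, inv_one, MulAut.one_apply, Pi.mul_apply]
      rfl
    have hF2 : F' (coprodGen A) = ⟨β, coprodGen A⟩ := by
      simp [F', coprodGen]
    refine ⟨uncurry F' ?_, ?_, ?_⟩
    · suffices SemidirectProduct.rightHom.comp F' = MonoidHom.id _ by
        exact DFunLike.ext_iff.mp this
      apply Coprod.hom_ext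
      · ext g
        simp [F']
      · ext
        simp [F', coprodGen]
    · rintro ⟨⟨⟩, a : X⟩ ⟨⟨⟩, b⟩ (⟨⟨h⟩⟩ | ⟨⟨h1, h2⟩⟩)
      · change (F' (coprodGen A)).left _ = _
        rw [hF2]
        cases inv_smul_eq_iff.mpr h.symm
        rfl
      · change (F' (Coprod.inl (T.tr b))).left b = _
        change X at b
        have h3 : (Coprod.inl (T.tr b) : Coprod A Zm)⁻¹ • b = T.rep b := by
          rw [inv_smul_eq_iff, T.tr_smul]
        have h4 : τ (T.rep b) = 1 := dif_pos (T.rep_rep b).symm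
        have h5 : τ b = @f ⟨(), T.rep b⟩ ⟨(), b⟩ (Sum.inr ⟨rfl, h2⟩) := dif_neg h2
        change a = T.rep b at h1
        subst h1
        rw [hF1, h3, h4, inv_one, mul_one, h5]
    · intro E hE
      obtain ⟨cE, hcE⟩ : ∃ cE : Coprod A Zm →* (X → H) ⋊[mulAutArrow] (Coprod A Zm),
        cE = curry E := ⟨_, rfl⟩
      have hmap : ∀ ⦃a b : ActionCategory (Coprod A Zm) X⦄ (q : a ⟶ b),
          (cE q.val).left b.back = E.map q := by
        subst hcE
        apply ActionCategory.cases
        intros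
        rfl
      have hright : ∀ g, (cE g).right = g := by
        subst hcE
        exact fun g => rfl
      have hmul : ∀ (g h : Coprod A Zm) (b : X),
          (cE (g * h)).left b = (cE g).left b * (cE h).left (g⁻¹ • b) := by
        intro g h b
        rw [map_mul, SemidirectProduct.mul_left, hright]
        rfl
      have hτ : ∀ b : X, (cE (Coprod.inl (T.tr b))).left b = τ b := by
        intro b
        by_cases h : b = T.rep b
        · rw [T.tr_eq_one hfree h, map_one, map_one]
          exact (dif_pos h : τ b = 1).symm
        · have h5 : τ b = @f ⟨(), T.rep b⟩ ⟨(), b⟩ (Sum.inr ⟨rfl, h⟩) := dif_neg h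
          exact ((hmap _).trans (hE ⟨(), T.rep b⟩ ⟨(), b⟩ (Sum.inr ⟨rfl, h⟩))).trans h5.symm
      have hβ : ∀ b : X, (cE (coprodGen A)).left b = β b := fun b =>
        (hmap _).trans (hE ⟨(), _⟩ ⟨(), b⟩ (Sum.inl ⟨smul_inv_smul (coprodGen A) b⟩))
      have key : cE = F' := by
        apply Coprod.hom_ext
        · ext g b
          · change (cE (Coprod.inl g)).left b = (F' (Coprod.inl g)).left b
            rw [hF1, _root_.eq_mul_inv_iff_mul_eq, ← hτ, ← hτ, ← hmul, ← map_mul,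
              ← T.tr_smul_eq hfree, smul_inv_smul]
          · simp [F', hright]
        · apply MonoidHom.ext_mint
          change cE (coprodGen A) = F' (coprodGen A)
          rw [hF2]
          ext b
          · exact hβ b
          · simp [hright]
      apply Functor.hext
      · intro
        apply Unit.ext
      · intro a b q
        exact heq_of_eq ((hmap q).symm.trans (congrArg
          (fun F : Coprod A Zm →* (X → H) ⋊[mulAutArrow] (Coprod A Zm) =>
            (F q.val).left b.back) key))

/-- A subgroup `K` of `A * ℤ` that meets every conjugate of `A` trivially is free: it is a vertex
group of the action groupoid on the cosets of `K`, and vertex groups of connected free groupoids are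
free. -/
theorem isFreeGroup_of_forall_conj (K : Subgroup (Coprod A Zm))
    (h : ∀ (g : A) (d : Coprod A Zm), d⁻¹ * Coprod.inl g * d ∈ K → g = 1) : IsFreeGroup K := by
  obtain ⟨T⟩ := nonempty_orbitTransversal (A := A) (X := Coprod A Zm ⧸ K)
  let _ : IsFreeGroupoid (ActionCategory (Coprod A Zm) (Coprod A Zm ⧸ K)) :=
    actionGroupoidIsFreeOfFree (by
      intro g x
      induction x using QuotientGroup.induction_on with | _ d =>
      intro hx
      apply h g d
      rw [MulAction.Quotient.smul_coe, eq_comm, QuotientGroup.eq] at hx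
      simpa [mul_assoc] using hx) T
  have hc : @IsConnected (ActionCategory (Coprod A Zm) (Coprod A Zm ⧸ K)) Groupoid.toCategory :=
    @CategoryTheory.ActionCategory.instIsConnectedOfIsPretransitiveOfNonempty (Coprod A Zm) _
      (Coprod A Zm ⧸ K) _ _ _
  have := IsFreeGroupoid.endIsFreeOfConnectedFree
    (objEquiv (Coprod A Zm) (Coprod A Zm ⧸ K) ((1 : Coprod A Zm) : Coprod A Zm ⧸ K))
  refine @IsFreeGroup.ofMulEquiv _ _ this K _ ?_
  exact endMulEquivSubgroup K

/-- A free subgroup of a group contains no nontrivial element of finite order, since free groups are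
torsion-free. -/
lemma eq_one_of_isFreeGroup {G : Type} [Group G] (K : Subgroup G) [IsFreeGroup K] {g : G}
    (hg : g ∈ K) {n : ℕ} (hn : n ≠ 0) (h : g ^ n = 1) : g = 1 := by
  have e := IsFreeGroup.mulEquiv K
  have h1 : (e.symm ⟨g, hg⟩) ^ n = 1 := by
    rw [← map_pow, map_eq_one_iff _ e.symm.injective]
    exact Subtype.ext h
  have h2 : e.symm ⟨g, hg⟩ = 1 := by
    exact (pow_eq_one_iff_left hn).1 h1
  rw [map_eq_one_iff _ e.symm.injective] at h2
  exact congrArg Subtype.val h2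

/-- The stabilizers of a permutation representation of `A * ℤ`, with `A` finite, are all free
exactly if `A` acts freely. -/
theorem forall_isFreeGroup_stab_iff [Finite A] {Y : Type} (ρ : Coprod A Zm →* Equiv.Perm Y) :
    (∀ y, IsFreeGroup (stab ρ y)) ↔ ∀ y, stab (ρ.comp Coprod.inl) y = ⊥ := by
  constructor
  · intro h y
    rw [eq_bot_iff]
    intro g hg
    have := h y
    have hg1 : (Coprod.inl g : Coprod A Zm) ∈ stab ρ y := mem_stab.2 (mem_stab.1 hg)
    have h2 := eq_one_of_isFreeGroup _ hg1 (Nat.card_pos (α := A)).ne' (by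
      rw [← map_pow, pow_card_eq_one', map_one])
    exact Coprod.inl_injective (h2.trans (map_one _).symm)
  · intro h y
    refine isFreeGroup_of_forall_conj _ fun g d hgd => ?_
    rw [← Subgroup.mem_bot, ← h (ρ d y), mem_stab]
    rw [mem_stab, map_mul, map_mul, Equiv.Perm.mul_apply, Equiv.Perm.mul_apply, map_inv,
      Equiv.Perm.inv_eq_iff_eq] at hgd
    exact hgd

end Free

/-! ### Finiteness of sets of homomorphisms -/

section FiniteHom

open Monoid

local notation "Zm" => Multiplicative ℤ

variable {A B M : Type*} [Group A] [Group B] [Group M]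

instance finite_hom_coprod [Finite (A →* M)] [Finite (B →* M)] : Finite (Coprod A B →* M) :=
  Finite.of_injective (fun f => (f.comp Coprod.inl, f.comp Coprod.inr)) fun _ _ h =>
    Coprod.hom_ext (Prod.ext_iff.1 h).1 (Prod.ext_iff.1 h).2

instance finite_hom_prod [Finite (A →* M)] [Finite (B →* M)] : Finite (A × B →* M) :=
  Finite.of_injective (fun f => (f.comp (MonoidHom.inl A B), f.comp (MonoidHom.inr A B)))
    fun f f' h => by
      ext ⟨a, b⟩
      have h1 := DFunLike.congr_fun (Prod.ext_iff.1 h).1 a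
      have h2 := DFunLike.congr_fun (Prod.ext_iff.1 h).2 b
      have h3 : ((a, b) : A × B) = (a, 1) * (1, b) := by simp
      rw [h3, map_mul, map_mul]
      exact congrArg₂ (· * ·) h1 h2

instance finite_hom_int [Finite M] : Finite (Zm →* M) := Finite.of_equiv M (zpowersHom M)

instance finite_hom_of_finite [Finite A] [Finite M] : Finite (A →* M) :=
  Finite.of_injective _ DFunLike.coe_injective

end FiniteHom

/-! ### Hypermaps and conjugacy classes of free subgroups -/

section Hypermap

open Monoid

local notation "Zm" => Multiplicative ℤ

/-- The homomorphism from the cyclic group of order `p` that sends the generator to `a`. -/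
def zmodPowHom {M : Type*} [Group M] (p : ℕ) (a : M) (h : a ^ p = 1) :
    Multiplicative (ZMod p) →* M :=
  AddMonoidHom.toMultiplicativeLeft (ZMod.lift p ⟨zmultiplesHom (Additive M) (Additive.ofMul a), by
    rw [zmultiplesHom_apply, natCast_zsmul, ← ofMul_pow, h, ofMul_one]⟩)

lemma zmodPowHom_ofAdd_one {M : Type*} [Group M] (p : ℕ) (a : M) (h : a ^ p = 1) :
    zmodPowHom p a h (Multiplicative.ofAdd 1) = a := by
  have := ZMod.lift_coe p ⟨zmultiplesHom (Additive M) (Additive.ofMul a), by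
    rw [zmultiplesHom_apply, natCast_zsmul, ← ofMul_pow, h, ofMul_one]⟩ 1
  rw [Int.cast_one] at this
  rw [zmodPowHom, AddMonoidHom.toMultiplicativeLeft_apply_apply, toAdd_ofAdd, this]
  simp

variable {p : ℕ}

/-- The permutation representation of `ℤ_p * ℤ` given by a hypermap. -/
def hypermapRep {n : ℕ} (H : PHypermap p n) : DeltaPlus p →* Equiv.Perm (Fin n) :=
  Coprod.lift (zmodPowHom p H.α (by
    ext x
    have := Function.iterate_minimalPeriod (f := H.α) (x := x)
    rw [H.edges, Equiv.Perm.iterate_eq_pow] at this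
    rw [this, Equiv.Perm.one_apply])) (zpowersHom _ H.σ)

lemma hypermapRep_inl {n : ℕ} (H : PHypermap p n) :
    hypermapRep H (Coprod.inl (Multiplicative.ofAdd 1)) = H.α := by
  simp [hypermapRep, zmodPowHom_ofAdd_one]

lemma hypermapRep_inr {n : ℕ} (H : PHypermap p n) :
    hypermapRep H (Coprod.inr (Multiplicative.ofAdd 1)) = H.σ := by
  simp [hypermapRep]

lemma hypermapRep_transitive {n : ℕ} (H : PHypermap p n) (x y : Fin n) :
    ∃ g, hypermapRep H g x = y := by
  obtain ⟨π, hπ, rfl⟩ := H.transitive x y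
  have : Subgroup.closure {H.α, H.σ} ≤ (hypermapRep H).range := by
    rw [Subgroup.closure_le]
    rintro _ (rfl | rfl)
    · exact ⟨_, hypermapRep_inl H⟩
    · exact ⟨_, hypermapRep_inr H⟩
  obtain ⟨g, rfl⟩ := this hπ
  exact ⟨g, rfl⟩

variable [NeZero p]

lemma ofAdd_eq_pow (g : Multiplicative (ZMod p)) :
    g = Multiplicative.ofAdd (1 : ZMod p) ^ (g.toAdd.val) := by
  rw [← ofAdd_nsmul]
  simp

lemma zmod_hom_ext {M : Type*} [Group M] {f g : Multiplicative (ZMod p) →* M}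
    (h : f (Multiplicative.ofAdd 1) = g (Multiplicative.ofAdd 1)) : f = g := by
  refine MonoidHom.ext fun x => ?_
  rw [ofAdd_eq_pow x, map_pow, map_pow, h]

lemma deltaPlus_hom_ext {M : Type*} [Group M] {f g : DeltaPlus p →* M}
    (h1 : f (Coprod.inl (Multiplicative.ofAdd 1)) = g (Coprod.inl (Multiplicative.ofAdd 1)))
    (h2 : f (Coprod.inr (Multiplicative.ofAdd 1)) = g (Coprod.inr (Multiplicative.ofAdd 1))) :
    f = g :=
  Coprod.hom_ext (zmod_hom_ext h1) (MonoidHom.ext_mint h2)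

/-- The cyclic group of order `p` acts freely on the orbit of `y` exactly if its generator has
period `p` at `y`. -/
lemma stab_eq_bot_iff {Y : Type*} (ρ : Multiplicative (ZMod p) →* Equiv.Perm Y) (y : Y) :
    stab ρ y = ⊥ ↔ Function.minimalPeriod (ρ (Multiplicative.ofAdd 1)) y = p := by
  have hpow : ∀ k : ℕ, ((ρ (Multiplicative.ofAdd 1))^[k]) y = y ↔
      Multiplicative.ofAdd (k : ZMod p) ∈ stab ρ y := by
    intro k
    rw [mem_stab, Equiv.Perm.iterate_eq_pow, ← map_pow, ← ofAdd_nsmul, nsmul_one]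
  constructor
  · intro h
    apply Nat.dvd_antisymm
    · apply Function.IsPeriodicPt.minimalPeriod_dvd
      rw [Function.IsPeriodicPt, Function.IsFixedPt, hpow]
      simp [one_mem]
    · have h1 := (hpow _).1 (Function.iterate_minimalPeriod
        (f := ρ (Multiplicative.ofAdd 1)) (x := y))
      rw [h, Subgroup.mem_bot, ofAdd_eq_one] at h1
      exact (ZMod.natCast_eq_zero_iff _ _).1 h1
  · intro h
    rw [eq_bot_iff]
    intro g hg
    have h1 : Multiplicative.ofAdd (g.toAdd.val : ZMod p) ∈ stab ρ y := by simpa using hg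
    have h2 := Function.IsPeriodicPt.minimalPeriod_dvd ((hpow _).2 h1)
    rw [h, ← ZMod.natCast_eq_zero_iff] at h2
    simpa using h2

lemma isFreeGroup_stab_hypermapRep {n : ℕ} (H : PHypermap p n) (x : Fin n) :
    IsFreeGroup (stab (hypermapRep H) x) := by
  revert x
  rw [forall_isFreeGroup_stab_iff]
  intro x
  rw [stab_eq_bot_iff, MonoidHom.comp_apply, hypermapRep_inl, H.edges]

/-- Every transitive representation of `ℤ_p * ℤ` with free stabilizers comes from a hypermap. -/
lemma exists_hypermapRep_eq {n : ℕ} (hn : 0 < n) (ρ : DeltaPlus p →* Equiv.Perm (Fin n))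
    (htrans : ∀ x y, ∃ g, ρ g x = y) (hfree : ∀ x, IsFreeGroup (stab ρ x)) :
    ∃ H : PHypermap p n, hypermapRep H = ρ := by
  refine ⟨⟨ρ (Coprod.inl (Multiplicative.ofAdd 1)), ρ (Coprod.inr (Multiplicative.ofAdd 1)),
    hn, ?_, ?_⟩, deltaPlus_hom_ext (hypermapRep_inl _) (hypermapRep_inr _)⟩
  · intro x y
    obtain ⟨g, hg⟩ := htrans x y
    refine ⟨ρ g, ?_, hg⟩
    clear hg
    induction g using Coprod.induction_on with
    | inl a =>
      rw [ofAdd_eq_pow a, map_pow, map_pow]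
      exact pow_mem (Subgroup.subset_closure (by simp)) _
    | inr z =>
      have : z = Multiplicative.ofAdd 1 ^ z.toAdd := by rw [← ofAdd_zsmul]; simp
      rw [this, map_zpow, map_zpow]
      exact zpow_mem (Subgroup.subset_closure (by simp)) _
    | mul a b ha hb =>
      rw [map_mul]
      exact mul_mem ha hb
  · intro x
    have := (forall_isFreeGroup_stab_iff ρ).1 hfree x
    rwa [stab_eq_bot_iff] at this

/-- Transitive representations with a common point stabilizer are isomorphic. -/
lemma exists_equivariant_equiv {Γ X Y : Type} [Group Γ] (ρ : Γ →* Equiv.Perm X)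
    (ρ' : Γ →* Equiv.Perm Y) (x : X) (y : Y) (hx : ∀ x', ∃ g, ρ g x = x')
    (hy : ∀ y', ∃ g, ρ' g y = y') (h : stab ρ x = stab ρ' y) :
    ∃ ψ : X ≃ Y, ∀ g z, ψ (ρ g z) = ρ' g (ψ z) := by
  have key : ∀ a b : Γ, ρ a x = ρ b x ↔ ρ' a y = ρ' b y := by
    intro a b
    have h1 : b⁻¹ * a ∈ stab ρ x ↔ b⁻¹ * a ∈ stab ρ' y := by rw [h]
    simpa only [mem_stab, map_mul, map_inv, Equiv.Perm.mul_apply, Equiv.Perm.inv_eq_iff_eq]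
      using h1
  choose t ht using hx
  refine ⟨Equiv.ofBijective (fun z => ρ' (t z) y) ⟨fun z w hzw => ?_, fun y' => ?_⟩, ?_⟩
  · rw [← ht z, ← ht w]
    exact (key _ _).2 hzw
  · obtain ⟨g, hg⟩ := hy y'
    refine ⟨ρ g x, ?_⟩
    change ρ' (t (ρ g x)) y = y'
    rw [← hg, ← key, ht]
  · intro g z
    change ρ' (t (ρ g z)) y = ρ' g (ρ' (t z) y)
    rw [← Equiv.Perm.mul_apply, ← map_mul, ← key, ht, map_mul, Equiv.Perm.mul_apply, ht]

/-- The free subgroup of index `n` that fixes the first dart of a hypermap. -/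
def hypermapSubgroup {n : ℕ} (H : PHypermap p n) : FreeSubgroupOfIndex (DeltaPlus p) n :=
  ⟨stab (hypermapRep H) ⟨0, H.nonempty⟩, isFreeGroup_stab_hypermapRep H _, by
    have h := index_stab_of_transitive (hypermapRep H) ⟨0, H.nonempty⟩ (hypermapRep_transitive H _)
    rw [Nat.card_eq_fintype_card, Fintype.card_fin] at h
    exact ⟨Subgroup.finiteIndex_iff.2 (h.trans_ne H.nonempty.ne'), h⟩⟩

lemma hypermap_iso_iff {n : ℕ} (H H' : PHypermap p n) :
    (hypermapSetoid p n).r H H' ↔ (freeSubgroupSetoid (DeltaPlus p) n).r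
      (hypermapSubgroup H) (hypermapSubgroup H') := by
  constructor
  · rintro ⟨ψ, h1, h2⟩
    have h3 : (MulAut.conj ψ).toMonoidHom.comp (hypermapRep H) = hypermapRep H' := by
      apply deltaPlus_hom_ext
      · simp [hypermapRep_inl, h1]
      · simp [hypermapRep_inr, h2]
    obtain ⟨g, hg⟩ := hypermapRep_transitive H ⟨0, H.nonempty⟩ (ψ⁻¹ ⟨0, H.nonempty⟩)
    refine ⟨g, ?_⟩
    change stab (hypermapRep H') _ = (stab (hypermapRep H) _).map _
    rw [← stab_apply, ← h3, hg]
    ext g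
    simp [mem_stab, Equiv.eq_symm_apply]
  · rintro ⟨g, hg⟩
    change stab (hypermapRep H') _ = (stab (hypermapRep H) _).map _ at hg
    rw [← stab_apply] at hg
    obtain ⟨ψ, hψ⟩ := exists_equivariant_equiv (hypermapRep H) (hypermapRep H') _ _
      (hypermapRep_transitive H _) (hypermapRep_transitive H' _) hg.symm
    refine ⟨ψ, ?_, ?_⟩
    · ext x
      rw [← hypermapRep_inl, ← hypermapRep_inl, Equiv.Perm.mul_apply, Equiv.Perm.mul_apply, hψ]
      simp
    · ext x
      rw [← hypermapRep_inr, ← hypermapRep_inr, Equiv.Perm.mul_apply, Equiv.Perm.mul_apply, hψ]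
      simp

/-- Every free subgroup of finite index is a point stabilizer of the action on its cosets, and so it
is conjugate to the subgroup of a hypermap. -/
lemma exists_conj_hypermapSubgroup {n : ℕ} (K : FreeSubgroupOfIndex (DeltaPlus p) n) :
    ∃ H : PHypermap p n, (freeSubgroupSetoid (DeltaPlus p) n).r (hypermapSubgroup H) K := by
  obtain ⟨K, hK, hfin, rfl⟩ := K
  have hpos : 0 < K.index := Nat.pos_of_ne_zero hfin.index_ne_zero
  let e : DeltaPlus p ⧸ K ≃ Fin K.index := Finite.equivFin (DeltaPlus p ⧸ K)
  let ρ : DeltaPlus p →* Equiv.Perm (Fin K.index) :=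
    e.permCongrHom.toMonoidHom.comp (MulAction.toPermHom (DeltaPlus p) (DeltaPlus p ⧸ K))
  have hρ : ∀ g q, ρ g (e q) = e (g • q) := by
    intro g q
    simp [ρ]
  have hstab : stab ρ (e ((1 : DeltaPlus p) : DeltaPlus p ⧸ K)) = K := by
    ext g
    rw [mem_stab, hρ, EmbeddingLike.apply_eq_iff_eq, ← MulAction.mem_stabilizer_iff,
      MulAction.stabilizer_quotient]
  have htrans : ∀ x y, ∃ g, ρ g x = y := by
    intro x y
    obtain ⟨g, hg⟩ := MulAction.exists_smul_eq (DeltaPlus p) (e.symm x) (e.symm y)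
    refine ⟨g, ?_⟩
    have := hρ g (e.symm x)
    rwa [hg, e.apply_symm_apply, e.apply_symm_apply] at this
  have hfree : ∀ x, IsFreeGroup (stab ρ x) := by
    intro x
    obtain ⟨g, rfl⟩ := htrans (e ((1 : DeltaPlus p) : DeltaPlus p ⧸ K)) x
    rw [stab_apply, hstab]
    exact IsFreeGroup.ofMulEquiv (K.equivMapOfInjective _ (MulAut.conj g).injective)
  obtain ⟨H, hH⟩ := exists_hypermapRep_eq hpos ρ htrans hfree
  obtain ⟨g, hg⟩ := htrans ⟨0, hpos⟩ (e ((1 : DeltaPlus p) : DeltaPlus p ⧸ K))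
  refine ⟨H, g, ?_⟩
  change K = (stab (hypermapRep H) _).map _
  rw [← stab_apply, hH, hg, hstab]

/-- Isomorphism classes of hypermaps correspond to conjugacy classes of free subgroups. -/
theorem card_freeSubgroupConjClass_eq (n : ℕ) :
    Nat.card (FreeSubgroupConjClass (DeltaPlus p) n) = Nat.card (HypermapIsoClass p n) := by
  symm
  refine Nat.card_congr (Equiv.ofBijective (Quotient.map hypermapSubgroup
    fun H H' h => (hypermap_iso_iff H H').1 h) ⟨?_, ?_⟩)
  · intro a b
    induction a, b using Quotient.inductionOn₂ with | _ a b =>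
    intro h
    exact Quotient.sound ((hypermap_iso_iff a b).2 (Quotient.exact h))
  · intro K
    induction K using Quotient.inductionOn with | _ K =>
    obtain ⟨H, hH⟩ := exists_conj_hypermapSubgroup K
    exact ⟨Quotient.mk _ H, Quotient.sound hH⟩

lemma finite_freeSubgroupConjClass (n : ℕ) : Finite (FreeSubgroupConjClass (DeltaPlus p) n) := by
  have : Finite (FreeSubgroupOfIndex (DeltaPlus p) n) := by
    by_cases hn : n = 0
    · have : IsEmpty (FreeSubgroupOfIndex (DeltaPlus p) n) :=
        ⟨fun K => K.2.2.1.index_ne_zero (K.2.2.2.trans hn)⟩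
      infer_instance
    · have := finite_subgroupsWith (fun K : Subgroup (DeltaPlus p) => IsFreeGroup K) hn
      exact Finite.of_injective
        (fun K => (⟨K.1, K.2.1, K.2.2.2⟩ : SubgroupsWith (fun K => IsFreeGroup K) n))
        fun a b h => Subtype.ext (congrArg (fun K => K.1) h)
  infer_instance

end Hypermap

/-! ### Counting representations of `ℤ × (ℤ_p * ℤ)` and of `ℤ × ℤ_p` -/

section Centralizer

lemma cycleType_eq_replicate {n m : ℕ} (π : Equiv.Perm (Fin n))
    (h : ∀ x, Function.minimalPeriod π x = m) :
    π.cycleType = Multiset.replicate (Multiset.card π.cycleType) m := by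
  rw [Multiset.eq_replicate_card]
  intro k hk
  rw [Equiv.Perm.cycleType_def, Multiset.mem_map] at hk
  obtain ⟨c, hc, rfl⟩ := hk
  have hc : c ∈ π.cycleFactorsFinset := hc
  have hcyc := (Equiv.Perm.mem_cycleFactorsFinset_iff.1 hc).1
  obtain ⟨x, hx⟩ := hcyc.nonempty_support
  have hpow : ∀ k : ℕ, π^[k] x = x ↔ orderOf c ∣ k := by
    intro k
    rw [orderOf_dvd_iff_pow_eq_one, hcyc.pow_eq_one_iff' (Equiv.Perm.mem_support.1 hx),
      Equiv.Perm.cycle_is_cycleOf hx hc, Equiv.Perm.cycleOf_pow_apply_self,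
      Equiv.Perm.iterate_eq_pow]
  rw [Function.comp_apply, ← hcyc.orderOf, ← h x]
  exact Nat.dvd_antisymm ((hpow _).1 Function.iterate_minimalPeriod)
    (Function.IsPeriodicPt.minimalPeriod_dvd ((hpow _).2 dvd_rfl))

/-- The centralizer of a permutation of `m i` points all of whose cycles have length `m`. -/
lemma card_centralizer_of_minimalPeriod {m i : ℕ} (hm : m ≠ 0) (π : Equiv.Perm (Fin (m * i)))
    (h : ∀ x, Function.minimalPeriod π x = m) :
    Nat.card (Subgroup.centralizer {π}) = m ^ i * i ! := by
  -- `cycleType` leaves out the fixed points, so that `m = 1` is a separate case.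
  by_cases h1 : m = 1
  · subst h1
    have : π = 1 := by
      ext x
      have := Function.minimalPeriod_eq_one_iff_isFixedPt.1 (h x)
      rw [this]; rfl
    subst this
    rw [Equiv.Perm.nat_card_centralizer]
    simp
  · have hc := cycleType_eq_replicate π h
    have hs : π.cycleType.sum = m * i := by
      rw [Equiv.Perm.sum_cycleType]
      have : π.support = Finset.univ := by
        ext x
        simp only [Equiv.Perm.mem_support, Finset.mem_univ, iff_true]
        intro hx
        have := Function.minimalPeriod_eq_one_iff_isFixedPt.2 hx
        rw [h] at this
        exact h1 this
      rw [this, Finset.card_univ, Fintype.card_fin]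
    have hcard : Multiset.card π.cycleType = i := by
      rw [hc, Multiset.sum_replicate, smul_eq_mul, mul_comm] at hs
      exact Nat.eq_of_mul_eq_mul_left (Nat.pos_of_ne_zero hm) hs
    rw [Equiv.Perm.nat_card_centralizer, hs, Fintype.card_fin, Nat.sub_self, hc, hcard]
    rcases Nat.eq_zero_or_pos i with rfl | hi
    · simp
    · rw [Multiset.toFinset_replicate]
      simp [hi.ne']

end Centralizer

section Count

open Monoid

local notation "Zm" => Multiplicative ℤ

variable {p : ℕ}

/-- The stabilizer of `x` meets `ℤ` in `mℤ` exactly if the cycle of `x` under the generator of `ℤ`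
has length `m`. -/
lemma comap_inl_stab_eq_iff {G : Type} [Group G] {n m : ℕ} (ρ : Zm × G →* Equiv.Perm (Fin n))
    (x : Fin n) :
    (stab ρ x).comap (MonoidHom.inl _ _) = Subgroup.zpowers (Multiplicative.ofAdd (m : ℤ)) ↔
      Function.minimalPeriod (ρ (Multiplicative.ofAdd 1, 1)) x = m := by
  obtain ⟨j, hj⟩ := exists_eq_zpowers_ofAdd ((stab ρ x).comap (MonoidHom.inl _ _))
  have hk : ∀ k : ℕ, ((ρ (Multiplicative.ofAdd 1, 1))^[k]) x = x ↔ j ∣ k := by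
    intro k
    rw [← Int.natCast_dvd_natCast, ← toAdd_ofAdd (k : ℤ), ← mem_zpowers_ofAdd, ← hj,
      Subgroup.mem_comap, mem_stab, Equiv.Perm.iterate_eq_pow, ← map_pow]
    simp [← ofAdd_nsmul]
  have hjm : Function.minimalPeriod (ρ (Multiplicative.ofAdd 1, 1)) x = j := by
    apply Nat.dvd_antisymm
    · exact Function.IsPeriodicPt.minimalPeriod_dvd ((hk j).2 dvd_rfl)
    · exact (hk _).1 (Function.iterate_minimalPeriod)
  rw [hj, hjm]
  exact zpowers_ofAdd_injective.eq_iff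

/-- The restriction of a representation of `ℤ × (ℤ_p * ℤ)` to `ℤ × ℤ_p`. -/
def restrictLeft {X : Type} (ρ : Zm × DeltaPlus p →* Equiv.Perm X) :
    Zm × Multiplicative (ZMod p) →* Equiv.Perm X :=
  ρ.comp (MonoidHom.prodMap (MonoidHom.id Zm) Coprod.inl)

/-- A representation of `ℤ × ℤ_p` extends to `ℤ × (ℤ_p * ℤ)`, with any given permutation that
commutes with the action of `ℤ` as the image of the generator of the free factor `ℤ`. -/
lemma exists_extension_of_restrictLeft {X : Type} (ρ : Zm × Multiplicative (ZMod p) →* Equiv.Perm X)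
    (σ : Equiv.Perm X) (hσ : σ ∈ Subgroup.centralizer {ρ (Multiplicative.ofAdd 1, 1)}) :
    ∃ ρ' : Zm × DeltaPlus p →* Equiv.Perm X, restrictLeft ρ' = ρ ∧
      ρ' (1, Coprod.inr (Multiplicative.ofAdd 1)) = σ := by
  rw [Subgroup.mem_centralizer_singleton_iff] at hσ
  let f : DeltaPlus p →* Equiv.Perm X :=
    Coprod.lift (ρ.comp (MonoidHom.inr _ _)) (zpowersHom _ σ)
  have hcomm : ∀ z g, Commute (ρ.comp (MonoidHom.inl _ _) z) (f g) := by
    intro z g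
    have hz : ρ.comp (MonoidHom.inl _ _) z = ρ (Multiplicative.ofAdd 1, 1) ^ z.toAdd := by
      rw [← map_zpow]
      simp [← ofAdd_zsmul]
    induction g using Coprod.induction_on with
    | inl a =>
      simp only [f, Coprod.lift_apply_inl, MonoidHom.comp_apply]
      exact (Commute.map (show Commute ((z, 1) : Zm × Multiplicative (ZMod p)) (1, a) by
        simp [Commute, SemiconjBy]) ρ)
    | inr w =>
      rw [hz]
      simp only [f, Coprod.lift_apply_inr, zpowersHom_apply]
      exact (show Commute _ _ from hσ.symm).zpow_zpow _ _
    | mul a b ha hb =>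
      rw [map_mul]
      exact ha.mul_right hb
  refine ⟨MonoidHom.noncommCoprod _ f hcomm, ?_, ?_⟩
  · refine MonoidHom.ext fun ⟨z, a⟩ => ?_
    simp [restrictLeft, f, ← map_mul]
  · simp only [f, MonoidHom.noncommCoprod_apply, map_one, one_mul, Coprod.lift_apply_inr,
      zpowersHom_apply, toAdd_ofAdd, zpow_one]

variable [NeZero p]

lemma forall_prodCond_restrictLeft_iff {X : Type} (m : ℕ)
    (ρ : Zm × DeltaPlus p →* Equiv.Perm X) :
    (∀ x, ProdCond (fun K : Subgroup (Multiplicative (ZMod p)) => K = ⊥) m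
      (stab (restrictLeft ρ) x)) ↔
    ∀ x, ProdCond (fun K : Subgroup (DeltaPlus p) => IsFreeGroup K) m (stab ρ x) := by
  simp only [ProdCond, forall_and]
  refine and_congr ?_ ?_
  · refine forall_congr' fun x => ?_
    have : (stab (restrictLeft ρ) x).comap (MonoidHom.inl _ _) =
        (stab ρ x).comap (MonoidHom.inl _ _) := by
      ext g
      simp [mem_stab, restrictLeft]
    rw [this]
  · change _ ↔ ∀ x, IsFreeGroup (stab (ρ.comp (MonoidHom.inr Zm (DeltaPlus p))) x)
    rw [forall_isFreeGroup_stab_iff]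
    refine forall_congr' fun x => ?_
    have : (stab (restrictLeft ρ) x).comap (MonoidHom.inr _ _) =
        stab ((ρ.comp (MonoidHom.inr _ _)).comp Coprod.inl) x := by
      ext g
      simp [mem_stab, restrictLeft]
    rw [this]

/-- A representation of `ℤ × (ℤ_p * ℤ)` is a representation of `ℤ × ℤ_p` together with a permutation
that commutes with the action of `ℤ`. Stabilizers meet `ℤ_p * ℤ` in free subgroups exactly if `ℤ_p`
acts freely. -/
noncomputable def repsWithProdEquiv (m n : ℕ) :
    RepsWith (ProdCond (fun K : Subgroup (DeltaPlus p) => IsFreeGroup K) m) (Fin n) ≃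
      Σ ρ : RepsWith (ProdCond (fun K : Subgroup (Multiplicative (ZMod p)) => K = ⊥) m) (Fin n),
        Subgroup.centralizer {ρ.1 (Multiplicative.ofAdd 1, 1)} :=
  Equiv.ofBijective (fun ρ => ⟨⟨restrictLeft ρ.1, (forall_prodCond_restrictLeft_iff m ρ.1).2 ρ.2⟩,
    ⟨ρ.1 (1, Coprod.inr (Multiplicative.ofAdd 1)), by
      rw [Subgroup.mem_centralizer_singleton_iff]
      simp [restrictLeft, ← map_mul]⟩⟩) <| by
    constructor
    · intro ρ ρ' h
      have h1 : restrictLeft ρ.1 = restrictLeft ρ'.1 := congrArg (fun t => t.1.1) h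
      have h2 : ρ.1 (1, Coprod.inr (Multiplicative.ofAdd 1)) =
        ρ'.1 (1, Coprod.inr (Multiplicative.ofAdd 1)) := congrArg (fun t => t.2.1) h
      have h3 : ρ.1.comp (MonoidHom.inr _ _) = ρ'.1.comp (MonoidHom.inr _ _) := by
        refine deltaPlus_hom_ext ?_ h2
        have := DFunLike.congr_fun h1 (1, Multiplicative.ofAdd 1)
        simpa [restrictLeft] using this
      refine Subtype.ext (MonoidHom.ext fun ⟨z, g⟩ => ?_)
      have h4 : ((z, g) : Zm × DeltaPlus p) = (z, 1) * (1, g) := by simp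
      have h5 := DFunLike.congr_fun h1 (z, 1)
      have h6 := DFunLike.congr_fun h3 g
      simp only [restrictLeft, MonoidHom.comp_apply, MonoidHom.prodMap_def, MonoidHom.prod_apply,
        MonoidHom.coe_fst, MonoidHom.coe_snd, MonoidHom.id_apply, map_one] at h5
      rw [h4, map_mul, map_mul, h5]
      exact congrArg _ h6
    · rintro ⟨ρ, σ, hσ⟩
      obtain ⟨ρ', h1, h2⟩ := exists_extension_of_restrictLeft ρ.1 σ hσ
      refine ⟨⟨ρ', (forall_prodCond_restrictLeft_iff m ρ').1 (by rw [h1]; exact ρ.2)⟩, ?_⟩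
      exact Sigma.subtype_ext (Subtype.ext h1) h2

/-- All the centralizers that occur in `repsWithProdEquiv` have order `mⁱ i!`. This is the effect of
the Hadamard product with `Q_m`. -/
theorem repCount_free_eq {m : ℕ} (hm : m ≠ 0) (i : ℕ) :
    repCount (ProdCond (fun K : Subgroup (DeltaPlus p) => IsFreeGroup K) m) (m * i) =
      m ^ i * i ! *
        repCount (ProdCond (fun K : Subgroup (Multiplicative (ZMod p)) => K = ⊥) m) (m * i) := by
  have := finite_repsWith (ProdCond (fun K : Subgroup (Multiplicative (ZMod p)) => K = ⊥) m)
    (Fin (m * i))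
  have := Fintype.ofFinite
    (RepsWith (ProdCond (fun K : Subgroup (Multiplicative (ZMod p)) => K = ⊥) m) (Fin (m * i)))
  rw [repCount, Nat.card_congr (repsWithProdEquiv m (m * i)), Nat.card_sigma,
    Finset.sum_congr rfl fun ρ _ => card_centralizer_of_minimalPeriod hm _ fun x =>
      (comap_inl_stab_eq_iff ρ.1 x).1 (ρ.2 x).1]
  rw [Finset.sum_const, Finset.card_univ, ← Nat.card_eq_fintype_card, smul_eq_mul, mul_comm,
    repCount]

end Count

/-! ### Logarithmic derivatives of power series -/

section LogDerivative

open Finset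

/-- Coefficients of the equation `F' = T' F`. -/
lemma coeff_of_derivative_eq_mul {F T : ℚ⟦X⟧} (h : d⁄dX ℚ F = d⁄dX ℚ T * F) (i : ℕ) :
    (i : ℚ) * coeff i F =
      ∑ k ∈ range i, (((k + 1 : ℕ) : ℚ) * coeff (k + 1) T) * coeff (i - (k + 1)) F := by
  cases i with
  | zero => simp
  | succ i =>
    have h1 := congrArg (coeff i) h
    rw [coeff_derivative, coeff_mul, Nat.sum_antidiagonal_eq_sum_range_succ
      (fun a b => coeff a (d⁄dX ℚ T) * coeff b F)] at h1
    push_cast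
    rw [mul_comm, h1]
    refine sum_congr rfl fun k _ => ?_
    rw [coeff_derivative, mul_comm (coeff (k + 1) T)]

/-- A solution of `a' = c a` is determined by its constant term. -/
lemma eq_of_recursion {a b c : ℕ → ℚ} (h0 : a 0 = b 0)
    (ha : ∀ n : ℕ, (n : ℚ) * a n = ∑ k ∈ range n, c k * a (n - (k + 1)))
    (hb : ∀ n : ℕ, (n : ℚ) * b n = ∑ k ∈ range n, c k * b (n - (k + 1))) : a = b := by
  ext n
  induction n using Nat.strong_induction_on with | _ n ih =>
  rcases Nat.eq_zero_or_pos n with rfl | hn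
  · exact h0
  · have hn' : (n : ℚ) ≠ 0 := by exact_mod_cast hn.ne'
    apply mul_left_cancel₀ hn'
    rw [ha, hb]
    exact sum_congr rfl fun k hk => by rw [ih _ (by have := mem_range.1 hk; omega)]

/-- A power series with constant term `1` can be cancelled from a product. -/
lemma eq_of_convolution_eq {a c c' : ℕ → ℚ} (h0 : a 0 = 1)
    (h : ∀ n : ℕ, ∑ k ∈ range n, c k * a (n - (k + 1)) = ∑ k ∈ range n, c' k * a (n - (k + 1))) :
    c = c' := by
  ext n
  induction n using Nat.strong_induction_on with | _ n ih =>
  have h1 := h (n + 1)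
  rw [sum_range_succ, sum_range_succ, Nat.sub_self, h0, mul_one, mul_one] at h1
  rw [sum_congr rfl fun k hk => by rw [ih k (mem_range.1 hk)]] at h1
  exact add_left_cancel h1

lemma sum_range_mul_eq {m : ℕ} (hm : m ≠ 0) (g : ℕ → ℚ) (hg : ∀ k, ¬ m ∣ k → g k = 0) (i : ℕ) :
    ∑ k ∈ range (m * i), g (k + 1) = ∑ j ∈ range i, g (m * (j + 1)) := by
  induction i with
  | zero => simp
  | succ i ih =>
    rw [mul_add, mul_one, sum_range_add, ih, sum_range_succ]
    congr 1
    rw [sum_eq_single (m - 1)]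
    · congr 1
      rw [mul_add]
      omega
    · intro r hr hr'
      apply hg
      rw [add_assoc, Nat.dvd_add_right (dvd_mul_right _ _)]
      intro hd
      have := Nat.le_of_dvd (Nat.succ_pos _) hd
      have := mem_range.1 hr
      omega
    · intro h
      exact absurd (mem_range.2 (by omega)) h

lemma derivative_exp_subst {T : ℚ⟦X⟧} (hT : constantCoeff T = 0) :
    d⁄dX ℚ ((PowerSeries.exp ℚ).subst T) = d⁄dX ℚ T * (PowerSeries.exp ℚ).subst T := by
  rw [derivative_subst (HasSubst.of_constantCoeff_zero' hT), derivative_exp, mul_comm]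

lemma constantCoeff_exp_subst {T : ℚ⟦X⟧} (hT : constantCoeff T = 0) :
    constantCoeff ((PowerSeries.exp ℚ).subst T) = 1 := by
  have hs := HasSubst.of_constantCoeff_zero' hT
  have h1 : PowerSeries.exp ℚ = (PowerSeries.exp ℚ - 1) + 1 := by ring
  have h2 : constantCoeff ((PowerSeries.exp ℚ - 1).subst T) = 0 :=
    constantCoeff_subst_eq_zero hT _ (by simp)
  have h3 : (1 : ℚ⟦X⟧).subst T = (1 : ℚ⟦X⟧) := by
    rw [← coe_substAlgHom hs, map_one]
  rw [h1, subst_add hs, map_add, h2, h3, map_one, zero_add]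

lemma derivative_eq_derivative_logOf_mul {F : ℚ⟦X⟧} (hF : constantCoeff F = 1) :
    d⁄dX ℚ F = d⁄dX ℚ (logOf F) * F := by
  have hs : HasSubst (F - 1) := HasSubst.of_constantCoeff_zero' (by simp [hF])
  have h1 : d⁄dX ℚ (PowerSeries.log ℚ) * (1 + X) = 1 := by
    ext n
    rw [mul_add, mul_one, map_add, deriv_log]
    cases n with
    | zero => simp
    | succ n => simp [coeff_succ_mul_X, pow_succ, coeff_one]
  have h2 : (d⁄dX ℚ (PowerSeries.log ℚ)).subst (F - 1) * F = 1 := by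
    have h3 := congrArg (fun f : ℚ⟦X⟧ => f.subst (F - 1)) h1
    simp only [subst_mul hs, subst_add hs, subst_X hs] at h3
    rw [← coe_substAlgHom hs, map_one, coe_substAlgHom hs] at h3
    simpa using h3
  rw [logOf_eq, derivative_subst hs, map_sub, Derivation.map_one_eq_zero, sub_zero,
    mul_right_comm, h2, one_mul]

end LogDerivative

/-! ### The series `P_m` and `P_m ⊙ Q_m` -/

section Series

open Finset

local notation "Zm" => Multiplicative ℤ

variable {p : ℕ} [NeZero p]

/-- The exponential formula in the variable `z_m = zᵐ`, for the representations of `ℤ × G` in which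
all cycles of the generator of `ℤ` have length `m`. Only multiples of `m` occur as indices. -/
lemma mul_repCount_prodCond {G : Type} [Group G] [∀ n, Finite (Zm × G →* Equiv.Perm (Fin n))]
    {S : Subgroup G → Prop} (hS : ∀ L g, S L → S (L.map (MulAut.conj g).toMonoidHom))
    {m : ℕ} (hm : m ≠ 0) (i : ℕ) :
    (i : ℚ) * (repCount (ProdCond S m) (m * i) / ((m * i) ! : ℚ)) =
      ∑ j ∈ range i, ((Nat.card (SubgroupsWith (ProdCond S m) (m * (j + 1))) : ℚ) / m) *
        (repCount (ProdCond S m) (m * (i - (j + 1))) / ((m * (i - (j + 1))) ! : ℚ)) := by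
  have hm' : (m : ℚ) ≠ 0 := by exact_mod_cast hm
  have h := mul_repCount_div_factorial (prodCond_conj hS m) (m * i)
  rw [sum_range_mul_eq hm (fun k => (Nat.card (SubgroupsWith (ProdCond S m) k) : ℚ) *
    (repCount (ProdCond S m) (m * i - k) / ((m * i - k) ! : ℚ)))
    fun k hk => by rw [card_prodCond_of_not_dvd S hk]; simp] at h
  apply mul_left_cancel₀ hm'
  rw [← mul_assoc, ← Nat.cast_mul, h, mul_sum]
  refine sum_congr rfl fun j _ => ?_
  rw [Nat.mul_sub]
  field_simp

lemma bot_conj {C : Type} [Group C] (L : Subgroup C) (g : C) (h : L = ⊥) :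
    L.map (MulAut.conj g).toMonoidHom = ⊥ := by
  rw [h, Subgroup.map_bot]

lemma isFreeGroup_conj {G : Type} [Group G] (L : Subgroup G) (g : G) (h : IsFreeGroup L) :
    IsFreeGroup (L.map (MulAut.conj g).toMonoidHom) :=
  IsFreeGroup.ofMulEquiv (L.equivMapOfInjective _ (MulAut.conj g).injective)

/-- `P_m` counts the representations of `ℤ × ℤ_p` in which `ℤ_p` acts freely and all cycles of the
generator of `ℤ` have length `m`: both sides satisfy the same recursion. -/
theorem coeff_seriesP {m : ℕ} (hm : m ≠ 0) (i : ℕ) :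
    coeff i (seriesP p m) = repCount
      (ProdCond (fun K : Subgroup (Multiplicative (ZMod p)) => K = ⊥) m) (m * i) /
        ((m * i) ! : ℚ) := by
  have hp : p ≠ 0 := NeZero.ne p
  have hp' : (p : ℚ) ≠ 0 := by exact_mod_cast hp
  have hm' : (m : ℚ) ≠ 0 := by exact_mod_cast hm
  obtain ⟨T, hT⟩ : ∃ T : ℚ⟦X⟧, T = C (1 / ((m : ℚ) * (p : ℚ))) *
      ∑ d ∈ (Nat.gcd m p).divisors, C ((d : ℚ) * (Nat.totient d : ℚ)) * X ^ (p / d) := ⟨_, rfl⟩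
  have hdp : ∀ d ∈ (Nat.gcd m p).divisors, d ∣ p := fun d hd =>
    (Nat.dvd_of_mem_divisors hd).trans (Nat.gcd_dvd_right _ _)
  have hcoeff : ∀ i, coeff i T = 1 / ((m : ℚ) * (p : ℚ)) *
      ∑ d ∈ (Nat.gcd m p).divisors, if i = p / d then (d : ℚ) * (Nat.totient d : ℚ) else 0 := by
    intro i
    rw [hT, coeff_C_mul, map_sum]
    refine congrArg _ (sum_congr rfl fun d _ => ?_)
    rw [coeff_C_mul, coeff_X_pow, mul_ite, mul_one, mul_zero]
  have hT0 : constantCoeff T = 0 := by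
    rw [← coeff_zero_eq_constantCoeff_apply, hcoeff, sum_eq_zero, mul_zero]
    intro d hd
    rw [if_neg]
    exact (Nat.div_pos (Nat.le_of_dvd (Nat.pos_of_ne_zero hp) (hdp d hd))
      (Nat.pos_of_mem_divisors hd)).ne
  have hP : seriesP p m = (PowerSeries.exp ℚ).subst T := by rw [hT]; rfl
  have key := eq_of_recursion (a := fun i => coeff i (seriesP p m))
    (b := fun i => (repCount (ProdCond (fun K : Subgroup (Multiplicative (ZMod p)) => K = ⊥) m)
      (m * i) / ((m * i) ! : ℚ)))
    (c := fun k => ((k + 1 : ℕ) : ℚ) * coeff (k + 1) T) ?_ ?_ ?_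
  · exact congrFun key i
  · rw [hP, coeff_zero_eq_constantCoeff_apply, constantCoeff_exp_subst hT0, mul_zero,
      repCount_zero]
    simp
  · intro n
    rw [hP]
    exact coeff_of_derivative_eq_mul (derivative_exp_subst hT0) n
  · intro n
    rw [mul_repCount_prodCond bot_conj hm]
    refine sum_congr rfl fun k _ => ?_
    congr 1
    rw [card_prodCond_bot hm, hcoeff]
    have hcard : Nat.card (Multiplicative (ZMod p)) = p := by
      rw [Nat.card_congr Multiplicative.toAdd, Nat.card_zmod]
    rw [hcard]
    push_cast
    rw [sum_div, mul_sum, mul_sum]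
    refine sum_congr rfl fun d hd => ?_
    by_cases h : p / d = k + 1
    · rw [if_pos h, if_pos h.symm]
      have h1 : ((k + 1 : ℕ) : ℚ) * d = p := by
        rw [← h]
        exact_mod_cast Nat.div_mul_cancel (hdp d hd)
      push_cast at h1
      rw [← h1] at hp' ⊢
      have h2 : (k + 1 : ℚ) ≠ 0 := left_ne_zero_of_mul hp'
      have h3 : (d : ℚ) ≠ 0 := right_ne_zero_of_mul hp'
      field_simp
    · rw [if_neg h, if_neg fun h' => h h'.symm]
      simp

/-- `P_m ⊙ Q_m` counts the corresponding representations of `ℤ × (ℤ_p * ℤ)`. -/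
theorem coeff_hadamardProd {m : ℕ} (hm : m ≠ 0) (i : ℕ) :
    coeff i (hadamardProd m (seriesP p m) seriesQ) =
      repCount (ProdCond (fun K : Subgroup (DeltaPlus p) => IsFreeGroup K) m) (m * i) /
        ((m * i) ! : ℚ) := by
  have hm' : (m : ℚ) ≠ 0 := by exact_mod_cast hm
  rw [hadamardProd, coeff_mk, coeff_seriesP hm, repCount_free_eq hm, seriesQ, coeff_mk]
  have : (m : ℚ) ^ i * (i ! : ℚ) ≠ 0 := by positivity
  rw [mul_one, mul_div_assoc, div_self this, mul_one]
  push_cast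
  rw [mul_div_assoc]

/-- By the exponential formula, `log (P_m ⊙ Q_m)` counts the corresponding transitive
representations, that is, subgroups of `ℤ × (ℤ_p * ℤ)`. For `i = 0` both sides are `0`. -/
theorem coeff_logOf_hadamardProd {m : ℕ} (hm : m ≠ 0) (i : ℕ) :
    coeff i (logOf (hadamardProd m (seriesP p m) seriesQ)) =
      (Nat.card (SubgroupsWith
        (ProdCond (fun K : Subgroup (DeltaPlus p) => IsFreeGroup K) m) (m * i)) : ℚ) /
        ((m * i : ℕ) : ℚ) := by
  have hm' : (m : ℚ) ≠ 0 := by exact_mod_cast hm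
  obtain ⟨F, hF⟩ : ∃ F, F = hadamardProd m (seriesP p m) seriesQ := ⟨_, rfl⟩
  have hFc : ∀ i, coeff i F =
      repCount (ProdCond (fun K : Subgroup (DeltaPlus p) => IsFreeGroup K) m) (m * i) /
        ((m * i) ! : ℚ) := fun i => by rw [hF, coeff_hadamardProd hm]
  have hF1 : coeff 0 F = 1 := by
    rw [hFc, mul_zero, repCount_zero]
    simp
  have hF0 : constantCoeff F = 1 := by
    rw [← coeff_zero_eq_constantCoeff_apply, hF1]
  rw [← hF]
  cases i with
  | zero =>
    rw [coeff_zero_eq_constantCoeff_apply, constantCoeff_logOf hF0]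
    simp
  | succ i =>
    have h := congrFun (eq_of_convolution_eq (a := fun i => coeff i F)
      (c := fun k => ((k + 1 : ℕ) : ℚ) * coeff (k + 1) (logOf F))
      (c' := fun k => (Nat.card (SubgroupsWith
        (ProdCond (fun K : Subgroup (DeltaPlus p) => IsFreeGroup K) m) (m * (k + 1))) : ℚ) / m)
      hF1 fun n => by
        rw [← coeff_of_derivative_eq_mul (derivative_eq_derivative_logOf_mul hF0)]
        simp only [hFc]
        exact mul_repCount_prodCond isFreeGroup_conj hm n) i
    have h2 : ((i + 1 : ℕ) : ℚ) ≠ 0 := by positivity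
    rw [Nat.cast_mul, ← div_div, ← h, mul_div_cancel_left₀ _ h2]

theorem coeff_logTerm (n k : ℕ+) (N : ℕ) :
    coeff N (logTerm p n k) = if (n : ℕ) ∣ N then
      (Nat.card (SubgroupsWith
        (ProdCond (fun K : Subgroup (DeltaPlus p) => IsFreeGroup K) k) (N / n)) : ℚ) /
        ((N / n : ℕ) : ℚ) else 0 := by
  rw [logTerm, coeff_expand]
  by_cases hn : (n : ℕ) ∣ N
  · obtain ⟨M, rfl⟩ := hn
    rw [if_pos (dvd_mul_right _ _), Nat.mul_div_cancel_left _ n.pos]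
    by_cases hk : (k : ℕ) ∣ M
    · obtain ⟨i, rfl⟩ := hk
      rw [if_pos (by rw [← mul_assoc]; exact dvd_mul_right _ _), ← mul_assoc,
        Nat.mul_div_cancel_left _ (Nat.mul_pos n.pos k.pos), coeff_logOf_hadamardProd k.ne_zero]
    · rw [if_neg fun h => hk (Nat.dvd_of_mul_dvd_mul_left n.pos h), card_prodCond_of_not_dvd _ hk]
      simp
  · rw [if_neg hn, if_neg fun h => hn ((dvd_mul_right _ _).trans h)]

end Series

/-! ### Summation over `k` and `n` -/

section FormalSum

open Finset

/-- A formal sum over the positive integers in which only the divisors of some `M N` contribute to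
the coefficient of `z^N`. There is no contribution if `M N = 0`, since `Nat.divisors 0` is empty. -/
lemma hasFormalSum_of_divisors {f : ℕ+ → ℚ⟦X⟧} {s : ℚ⟦X⟧} (g : ℕ → ℕ → ℚ) (M : ℕ → ℕ)
    (hg : ∀ N (n : ℕ+), coeff N (f n) = g N n) (hzero : ∀ N n, n ∉ (M N).divisors → g N n = 0)
    (hsum : ∀ N, ∑ n ∈ (M N).divisors, g N n = coeff N s) : HasFormalSum f s := by
  let _ : TopologicalSpace ℚ := ⊥
  change HasSum f s
  rw [PowerSeries.WithPiTopology.hasSum_iff_hasSum_coeff]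
  intro N
  rw [← hsum N, ← sum_subtype_of_mem (g N) (p := fun n => 0 < n)
    fun n hn => Nat.pos_of_mem_divisors hn]
  have : (fun n => coeff N (f n)) = fun n : ℕ+ => g N n := funext fun n => hg N n
  rw [this]
  exact hasSum_sum_of_ne_finset_zero (f := fun n : ℕ+ => g N n) fun n hn =>
    hzero N n fun h => hn (Finset.mem_subtype.2 h)

end FormalSum

section Main

local notation "Zm" => Multiplicative ℤ

theorem mainTheorem12 (p : ℕ) (hp : 1 ≤ p) :
    (∀ n : ℕ, Finite (FreeSubgroupConjClass (DeltaPlus p) n)) ∧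
    conjugacyGrowthSeries p = hypermapGrowthSeries p ∧
    ∃ L : ℕ+ → PowerSeries ℚ,
      (∀ n : ℕ+, HasFormalSum (fun k : ℕ+ => logTerm p n k) (L n)) ∧
      HasFormalSum
        (fun n : ℕ+ => ((ArithmeticFunction.moebius (n : ℕ) : ℚ) / ((n : ℕ) : ℚ)) • L n)
        (conjugacyGrowthSeries p) := by
  have : NeZero p := ⟨by omega⟩
  refine ⟨finite_freeSubgroupConjClass, ?_, ?_⟩
  · ext n
    simp [conjugacyGrowthSeries, hypermapGrowthSeries, card_freeSubgroupConjClass_eq]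
  -- The number of subgroups of index `M` of `ℤ × (ℤ_p * ℤ)` with free intersection with `ℤ_p * ℤ`.
  let t : ℕ → ℕ := fun M => Nat.card (SubgroupsWith
    (fun L : Subgroup (Zm × DeltaPlus p) => IsFreeGroup (L.comap (MonoidHom.inr _ _))) M)
  have ht : ∀ M : ℕ, 0 < M →
      ∑ d ∈ M.divisors, (d : ℚ) * Nat.card (FreeSubgroupConjClass (DeltaPlus p) d) = t M := by
    intro M hM
    have := finite_subgroupsWith
      (fun L : Subgroup (Zm × DeltaPlus p) => IsFreeGroup (L.comap (MonoidHom.inr _ _))) hM.ne'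
    have h := card_subgroupsWith_free (G := DeltaPlus p) hM.ne' fun d hd =>
      finite_subgroupsWith (fun K : Subgroup (DeltaPlus p) => IsFreeGroup K) hd
    simp only [t]
    rw [h]
    push_cast
    rfl
  refine ⟨fun n => PowerSeries.mk fun N => if (n : ℕ) ∣ N then
    (t (N / n) : ℚ) / ((N / n : ℕ) : ℚ) else 0, fun n => ?_, ?_⟩
  · refine hasFormalSum_of_divisors (fun N k => if (n : ℕ) ∣ N then
      (Nat.card (SubgroupsWith
        (ProdCond (fun K : Subgroup (DeltaPlus p) => IsFreeGroup K) k) (N / n)) : ℚ) /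
        ((N / n : ℕ) : ℚ) else 0) (fun N => if (n : ℕ) ∣ N then N / n else 0)
      (fun N k => coeff_logTerm n k N) ?_ ?_
    · intro N k hk
      split_ifs at hk ⊢ with h
      · by_cases h0 : N / n = 0
        · simp [h0]
        · rw [card_prodCond_of_not_dvd _ fun hd => hk (Nat.mem_divisors.2 ⟨hd, h0⟩)]
          simp
      · rfl
    · intro N
      rw [coeff_mk]
      split_ifs with h
      · by_cases h0 : N / n = 0
        · simp [h0]
        · have := fun m => finite_subgroupsWith
            (ProdCond (fun K : Subgroup (DeltaPlus p) => IsFreeGroup K) m) h0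
          rw [← Finset.sum_div, ← Nat.cast_sum, sum_card_prodCond _ h0]
      · simp
  · refine hasFormalSum_of_divisors (fun N n => ((ArithmeticFunction.moebius n : ℚ) / (n : ℚ)) *
      if n ∣ N then (t (N / n) : ℚ) / ((N / n : ℕ) : ℚ) else 0) (fun N => N)
      (fun N n => by simp) ?_ ?_
    · intro N n hn
      split_ifs with h
      · have : N = 0 := by
          by_contra h0
          exact hn (Nat.mem_divisors.2 ⟨h, h0⟩)
        simp [this]
      · simp
    · intro N
      rw [conjugacyGrowthSeries, coeff_mk]
      rcases Nat.eq_zero_or_pos N with rfl | hN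
      · have : IsEmpty (FreeSubgroupOfIndex (DeltaPlus p) 0) :=
          ⟨fun K => K.2.2.1.index_ne_zero K.2.2.2⟩
        simp
      · have hN' : (N : ℚ) ≠ 0 := by exact_mod_cast hN.ne'
        have h := ArithmeticFunction.sum_eq_iff_sum_mul_moebius_eq.1 ht N hN
        rw [Nat.sum_divisorsAntidiagonal
          (fun a b => ((ArithmeticFunction.moebius a : ℤ) : ℚ) * (t b : ℚ))] at h
        apply mul_left_cancel₀ hN'
        rw [← h, Finset.mul_sum]
        refine Finset.sum_congr rfl fun d hd => ?_
        have hdN := Nat.dvd_of_mem_divisors hd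
        rw [if_pos hdN]
        obtain ⟨e, rfl⟩ := hdN
        have hd0 : d ≠ 0 := (Nat.pos_of_mem_divisors hd).ne'
        rw [Nat.mul_div_cancel_left _ (Nat.pos_of_ne_zero hd0)]
        push_cast at hN' ⊢
        have h1 := left_ne_zero_of_mul hN'
        have h2 := right_ne_zero_of_mul hN'
        field_simp

end Main
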